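/- **Setting.** Let $p$ be a prime, $q=p$ if $p\neq 2$ and $q=4$ if $p=2$. For $a\in\mathbb Z_p^\times$ let $\theta(a)$ be the root of unity of $\mathbb Z_p$ with $\theta(a)\equiv a \pmod q$, and $\langle a\rangle=a\,\theta(a)^{-1}\in 1+q\mathbb Z_p$; for $s\in\mathbb Z_p$ put $\langle a\rangle^s=\sum_{k\ge 0}\binom sk(\langle a\rangle-1)^k$. Let $K$ be a real abelian number field, i.e. a totally real subfield of some cyclotomic field (inside a fixed $\overline{\mathbb Q}$). The conductor $f_L$ of an abelian field $L$ is the least $m\ge 1$ with $L\subseteq\mathbb Q(\mu_m)$; for an integer $a$ prime to $f_L$, the Artin symbol $\left(\frac La\right)\in\mathrm{Gal}(L/\mathbb Q)$ is the restriction to $L$ of $\zeta\mapsto\zeta^a$ on $\mu_{f_L}$. For $n\ge 0$ put $L_n=K(\mu_{qp^n})$, let $f_n$ be the conductor of $L_n$, and $$\mathcal S_{L_n}=-\sum_{a}\Big(\frac a{f_n}-\frac12\Big)\Big(\frac{L_n}a\Big)^{-1}\in\mathbb Q[\mathrm{Gal}(L_n/\mathbb Q)],$$ where here and below $a$ runs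 over the integers of $[1,f_n]$ prime to $f_n$. Let $c$ be any odd integer prime to $p$ and to the conductor $f_K$ of $K$, and put $\mathcal S_{L_n}(c)=\big(1-c\left(\frac{L_n}c\right)^{-1}\big)\mathcal S_{L_n}$. For such $a$ let $a'_c\in[1,f_n]$ be the unique integer with $a'_c c\equiv a\pmod{f_n}$, and $\lambda_a^n(c)=(a'_c c-a)/f_n\in\mathbb Z$. On $A_n=(\mathbb Z_p/qp^n\mathbb Z_p)[\mathrm{Gal}(L_n/\mathbb Q)]$ the Mellin transform at $s\in\mathbb Z_p$ is the linear map with $\left(\frac{L_n}a\right)\mapsto\theta(a)\langle a\rangle^s\left(\frac{L_n}a\right)^{-1}$. For a primitive Dirichlet character $\chi$ of $K$ (a primitive character modulo $N$ which, as a character of $\mathrm{Gal}(\mathbb Q(\mu_N)/\mathbb Q)$ and hence of the absolute Galois group of $\mathbb Q$, is trivial on the automorphisms fixing $K$), with values in $\mathbb C_p$ and a fixed embedding $\iota:\mathbb C_p\to\mathbb C$ to compare with complex values, $L_p(s,\chi)$ is the $\mathbb C_p$-valued function, continuous on $\mathbb Z_p$ (on $\mathbb Z_p\setminus\{1\}$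 if $\chi=1$), such that for all integers $m\ge 1$ $$\iota\big(L_p(1-m,\chi)\big)=\big(1-\iota(\chi\theta^{-m}(p))\,p^{m-1}\big)\,L\big(1-m,\iota\circ\chi\theta^{-m}\big),$$ $\chi\theta^{-m}$ denoting the primitive Dirichlet character attached to the product. **Theorem.** 1. For all $n\ge 0$, $\mathcal S_{L_n}(c)=\sum_a\big[\lambda_a^n(c)+\frac{1-c}2\big]\left(\frac{L_n}a\right)^{-1}\in\mathbb Z[\mathrm{Gal}(L_n/\mathbb Q)]$, and $\mathcal S_{L_{n+1}}(c)$ restricts to $\mathcal S_{L_n}(c)$ on $L_n$. 2. Let $s\in\mathbb Z_p$ and let $\mathcal S^*_{L_n}(c)(s)\in A_n$ be the Mellin transform of $\mathcal S_{L_n}(c)$. These elements form a $p$-adic measure: the restriction of $\mathcal S^*_{L_{n+1}}(c)(s)$ to $L_n$ is congruent to $\mathcal S^*_{L_n}(c)(s)$ modulo $qp^n$. For all $n\ge0$, the restriction $\mathcal S^*_{K,n}(c)(s)$ of $\mathcal S^*_{L_n}(c)(s)$ to $K$ satisfies $$\mathcal S^*_{K,n}(c)(s)\equiv\sum_a\Big[\lambda_a^n(c)+\frac{1-c}2\Big]a^{-1}\langle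 a\rangle^{1-s}\Big(\frac Ka\Big)\pmod{qp^n}.$$ 3. Let $\chi$ be a primitive Dirichlet character of $K$, of conductor $N$. The function $L_p(s,\chi)$ exists and is unique, and for all $s\in\mathbb Z_p$ ($s\ne 1$ if $\chi=1$), with $\Sigma_n(s)=\sum_{a}\big[\lambda_a^n(c)+\frac{1-c}2\big]a^{-1}\langle a\rangle^{1-s}\chi(a)$, $$\lim_{n\to\infty}\Sigma_n(s)=\big(1-\chi(c)\langle c\rangle^{1-s}\big)\prod_{\ell\mid f_K,\ \ell\nmid pN}\big(1-\chi(\ell)\ell^{-1}\langle\ell\rangle^{1-s}\big)\cdot L_p(s,\chi),$$ and for each $n\ge 0$ the difference of $\Sigma_n(s)$ and its limit has absolute value at most $|qp^n|_p$. In particular, if every prime $\ell\ne p$ dividing $f_K$ divides $N$ (for instance if $K$ is the field cut out by $\chi$) and $1-\chi(c)\langle c\rangle^{1-s}\neq0$, then $$L_p(s,\chi)=\frac1{1-\chi(c)\langle c\rangle^{1-s}}\cdot\lim_{n\to\infty}\sum_{a}\Big[\lambda_a^n(c)+\frac{1-c}2\Big]a^{-1}\langle a\rangle^{1-s}\chi(a).$$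 -/

import Mathlib

open scoped Topology

namespace StickelbergerMeasure

noncomputable section

/-! ### Abelian number fields, conductors and Artin symbols -/

/-- The fixed algebraic closure of `ℚ` in which all number fields are taken. -/
abbrev QBar : Type := AlgebraicClosure ℚ

/-- The structure of `ℚ`-algebra inherited from `QBar`, made the preferred one. -/
instance (L : IntermediateField ℚ QBar) : Algebra ℚ L := L.algebra'

/-- The cyclotomic field `ℚ(μ_m)`. -/
def cyclo (m : ℕ) : IntermediateField ℚ QBar :=
  IntermediateField.adjoin ℚ {ζ : QBar | ζ ^ m = 1}

/-- Abelian number fields: the subfields of the cyclotomic fields `ℚ(μ_m)`, `m ≥ 1`. -/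
class IsAbelianField (L : IntermediateField ℚ QBar) : Prop where
  exists_le_cyclo : ∃ m : ℕ, 0 < m ∧ L ≤ cyclo m

/-- The conductor of an abelian field `L`: the least `m ≥ 1` such that `L ⊆ ℚ(μ_m)`. -/
def conductor (L : IntermediateField ℚ QBar) : ℕ :=
  sInf {m : ℕ | 0 < m ∧ L ≤ cyclo m}

theorem cyclo_mono {m m' : ℕ} (h : m ∣ m') : cyclo m ≤ cyclo m' := by
  refine IntermediateField.adjoin.mono ℚ _ _ fun ζ hζ => ?_
  obtain ⟨d, rfl⟩ := h
  have hζ' : ζ ^ m = 1 := hζ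
  simp [pow_mul, hζ']

theorem isAbelianGalois_cyclo {m : ℕ} (hm : 0 < m) : IsAbelianGalois ℚ (cyclo m) := by
  have : NeZero m := ⟨hm.ne'⟩
  have hset : {b : QBar | ∃ n ∈ ({m} : Set ℕ), n ≠ 0 ∧ b ^ n = 1} = {ζ : QBar | ζ ^ m = 1} := by
    ext; simp [hm.ne']
  have hc := IntermediateField.isCyclotomicExtension_adjoin_of_exists_isPrimitiveRoot {m} ℚ QBar
    (fun n hn hn0 => by
      have : NeZero n := ⟨hn0⟩
      exact HasEnoughRootsOfUnity.exists_primitiveRoot QBar n)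
  rw [hset] at hc
  exact @IsCyclotomicExtension.isAbelianGalois {m} ℚ (cyclo m) _ _ _ hc

instance (L : IntermediateField ℚ QBar) [h : IsAbelianField L] : Normal ℚ L := by
  obtain ⟨m, hm, hL⟩ := h.exists_le_cyclo
  have hG := isAbelianGalois_cyclo hm
  have hG' : IsAbelianGalois ℚ L := IsAbelianGalois.of_algHom (IntermediateField.inclusion hL)
  exact hG'.toIsGalois.to_normal

instance (m : ℕ) [NeZero m] : IsAbelianField (cyclo m) := ⟨m, NeZero.pos m, le_rfl⟩

instance (L M : IntermediateField ℚ QBar) [hL : IsAbelianField L] [hM : IsAbelianField M] :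
    IsAbelianField (L ⊔ M) := by
  obtain ⟨a, ha, hLa⟩ := hL.exists_le_cyclo
  obtain ⟨b, hb, hMb⟩ := hM.exists_le_cyclo
  exact ⟨a * b, Nat.mul_pos ha hb, sup_le (hLa.trans (cyclo_mono (Dvd.intro _ rfl)))
    (hMb.trans (cyclo_mono (Dvd.intro_left _ rfl)))⟩

/-- The Artin symbol `(L/a)` of an abelian field `L` and an integer `a` prime to its conductor `f`:
the restriction to `L` of the automorphisms acting on `μ_f` by `ζ ↦ ζ ^ a`.
(The value is `1` when no such automorphism exists, i.e. when `a` is not prime to `f`.) -/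
def artinSymbol (L : IntermediateField ℚ QBar) [IsAbelianField L] (a : ℤ) : Gal(L/ℚ) :=
  open Classical in
  if h : ∃ σ : Gal(QBar/ℚ), ∀ ζ : QBar, ζ ^ conductor L = 1 → σ ζ = ζ ^ a then
    AlgEquiv.restrictNormalHom L h.choose
  else 1

/-- The restriction `Gal(M/ℚ) → Gal(L/ℚ)` for `L ⊆ M`. -/
def restrictGal {L M : IntermediateField ℚ QBar} [IsAbelianField L] (h : L ≤ M) :
    Gal(M/ℚ) →* Gal(L/ℚ) :=
  letI : Algebra L M := (IntermediateField.inclusion h).toRingHom.toAlgebra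
  haveI : IsScalarTower ℚ L M := IsScalarTower.of_algebraMap_eq fun _ => rfl
  AlgEquiv.restrictNormalHom L

/-- The restriction (norm) map `R[Gal(M/ℚ)] → S[Gal(L/ℚ)]` for `L ⊆ M`, combined with a
homomorphism `R → S` on the coefficients. -/
def normMap {L M : IntermediateField ℚ QBar} [IsAbelianField L] (h : L ≤ M)
    {R S : Type} [CommRing R] [CommRing S] (φ : R →+* S) :
    MonoidAlgebra R Gal(M/ℚ) →+* MonoidAlgebra S Gal(L/ℚ) :=
  (MonoidAlgebra.mapRingHom Gal(L/ℚ) φ).comp (MonoidAlgebra.mapDomainRingHom R (restrictGal h))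

/-! ### Stickelberger elements -/

/-- The integers `a ∈ [1, f]` prime to `f`. -/
def primeTo (f : ℕ) : Finset ℕ := (Finset.Icc 1 f).filter fun a => a.Coprime f

/-- The Stickelberger element `-∑_a (a/f - 1/2) (L/a)⁻¹` of `L`, where `f` is the conductor of `L`
and `a ∈ [1, f]` is prime to `f`. -/
def stickelberger (L : IntermediateField ℚ QBar) [IsAbelianField L] :
    MonoidAlgebra ℚ Gal(L/ℚ) :=
  -∑ a ∈ primeTo (conductor L),
    MonoidAlgebra.single (artinSymbol L a)⁻¹ ((a : ℚ) / (conductor L : ℚ) - 1 / 2)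

/-- The twisted Stickelberger element `(1 - c (L/c)⁻¹) · S_L`. -/
def twistedStickelberger (L : IntermediateField ℚ QBar) [IsAbelianField L] (c : ℤ) :
    MonoidAlgebra ℚ Gal(L/ℚ) :=
  (1 - MonoidAlgebra.single (artinSymbol L c)⁻¹ (c : ℚ)) * stickelberger L

/-- The integer `a'_c ∈ [1, f]` such that `a'_c c ≡ a (mod f)`, for `c` prime to `f`. -/
def aPrime (f : ℕ) (c : ℤ) (a : ℕ) : ℕ :=
  sInf {b : ℕ | 1 ≤ b ∧ b ≤ f ∧ (f : ℤ) ∣ b * c - a}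

/-- The integer `λ_a(c)` such that `a'_c c - a = λ_a(c) f` (an exact division). -/
def lam (f : ℕ) (c : ℤ) (a : ℕ) : ℤ := (aPrime f c a * c - a) / f

/-- The integer `λ_a(c) + (1 - c)/2`, for odd `c`. -/
def twistCoeff (f : ℕ) (c : ℤ) (a : ℕ) : ℤ := lam f c a + (1 - c) / 2

/-! ### Teichmüller character and `p`-adic powers -/

theorem existsUnique_teich_aux (p : ℕ) [hp : Fact p.Prime] (e : ℕ)
    (he : (p = 2 ∧ e = 2) ∨ (p ≠ 2 ∧ e = 1)) (u : (ZMod (p ^ e))ˣ) :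
    ∃! ξ : ℤ_[p]ˣ, ξ ^ (p ^ e).totient = 1 ∧
      Units.map (PadicInt.toZModPow (p := p) e : ℤ_[p] →* ZMod (p ^ e)) ξ = u := by
  rcases he with ⟨rfl, rfl⟩ | ⟨h2, rfl⟩
  · have htot : (2 ^ 2).totient = 2 := by decide
    rw [htot]
    have key : ∀ v : (ZMod (2 ^ 2))ˣ, v = 1 ∨ v = -1 := by decide
    have hne : (1 : (ZMod (2 ^ 2))ˣ) ≠ -1 := by decide
    have hroot : ∀ ξ : ℤ_[2]ˣ, ξ ^ 2 = 1 → ξ = 1 ∨ ξ = -1 := by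
      intro ξ h
      have h' : (ξ : ℤ_[2]) ^ 2 = 1 := by simpa using congrArg Units.val h
      rcases (sq_eq_sq_iff_eq_or_eq_neg.mp (h'.trans (one_pow 2).symm)) with h | h
      · exact Or.inl (Units.ext h)
      · exact Or.inr (Units.ext (by simpa using h))
    set f := Units.map (PadicInt.toZModPow (p := 2) 2 : ℤ_[2] →* ZMod (2 ^ 2)) with hf
    have hf1 : f (-1) = -1 := by ext; simp [hf]
    rcases key u with rfl | rfl
    · refine ⟨1, ⟨one_pow _, map_one f⟩, ?_⟩
      rintro ξ ⟨h1, h3⟩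
      rcases hroot ξ h1 with rfl | rfl
      · rfl
      · exact absurd (h3.symm.trans hf1) hne
    · refine ⟨-1, ⟨by simp, hf1⟩, ?_⟩
      rintro ξ ⟨h1, h3⟩
      rcases hroot ξ h1 with rfl | rfl
      · exact absurd ((map_one f).symm.trans h3) hne
      · rfl
  · set k := (p ^ 1).totient with hk
    have hk' : k = p - 1 := by rw [hk, pow_one, Nat.totient_prime hp.out]
    have hp2 : 2 < p := lt_of_le_of_ne hp.out.two_le (Ne.symm h2)
    have hker : ∀ x : ℤ_[p], ‖x‖ < 1 ↔ PadicInt.toZModPow (p := p) 1 x = 0 := by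
      intro x
      rw [← RingHom.mem_ker, PadicInt.ker_toZModPow, Ideal.mem_span_singleton, pow_one,
        PadicInt.norm_lt_one_iff_dvd]
    have : NeZero (p ^ 1) := ⟨pow_ne_zero _ hp.out.ne_zero⟩
    set a : ℤ_[p] := ((u : ZMod (p ^ 1)).val : ℤ_[p]) with ha
    have hau : PadicInt.toZModPow (p := p) 1 a = u := by
      rw [ha, map_natCast, ZMod.natCast_zmod_val]
    have hunit : ∀ x : ℤ_[p], PadicInt.toZModPow (p := p) 1 x = u → ‖x‖ = 1 := by
      intro x hx
      refine le_antisymm (PadicInt.norm_le_one x) (not_lt.mp fun h => ?_)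
      rw [hker, hx] at h
      have : Nontrivial (ZMod (p ^ 1)) := by
        have : Fact (1 < p ^ 1) := ⟨by rw [pow_one]; exact hp.out.one_lt⟩
        infer_instance
      exact u.ne_zero h
    set F : Polynomial ℤ_[p] := Polynomial.X ^ k - 1 with hF
    have hFe : ∀ x : ℤ_[p], F.aeval x = x ^ k - 1 := by intro x; simp [hF]
    have hFa : ‖F.aeval a‖ < 1 := by
      rw [hker, hFe, map_sub, map_pow, hau, map_one, ← Units.val_pow_eq_pow_val,
        ZMod.pow_totient]
      simp
    have hF' : ‖F.derivative.aeval a‖ = 1 := by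
      have : F.derivative.aeval a = (k : ℤ_[p]) * a ^ (k - 1) := by
        simp [hF, Polynomial.derivative_X_pow]
      rw [this, norm_mul, norm_pow, hunit a hau, one_pow, mul_one]
      refine le_antisymm (PadicInt.norm_le_one _) (not_lt.mp fun h => ?_)
      have h' : (p : ℤ) ∣ (k : ℤ) := by
        rw [← PadicInt.norm_int_lt_one_iff_dvd]; exact_mod_cast h
      have h'' := Nat.le_of_dvd (by omega) (Int.natCast_dvd_natCast.mp h')
      omega
    obtain ⟨z, hz, hza, -, hzu⟩ := hensels_lemma (F := F) (a := a) (by rw [hF', one_pow]; exact hFa)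
    rw [hF'] at hza hzu
    rw [hFe, sub_eq_zero] at hz
    have hzmap : PadicInt.toZModPow (p := p) 1 z = u := by
      rw [hker, map_sub, hau, sub_eq_zero] at hza
      exact hza
    have hzunit : IsUnit z := PadicInt.isUnit_iff.mpr (hunit z hzmap)
    refine ⟨hzunit.unit, ⟨Units.ext (by simpa using hz), Units.ext (by simpa using hzmap)⟩, ?_⟩
    rintro ξ ⟨h1, h3⟩
    refine Units.ext (hzu _ ?_ ?_)
    · rw [hFe, sub_eq_zero]
      simpa using congrArg Units.val h1
    · rw [hker, map_sub, hau, sub_eq_zero]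
      simpa using congrArg Units.val h3

section padic

variable (p : ℕ) [Fact p.Prime]

/-- The exponent `e` such that `q = p ^ e`. -/
def qExp : ℕ := if p = 2 then 2 else 1

/-- `q = 4` if `p = 2`, and `q = p` otherwise. -/
abbrev q : ℕ := p ^ qExp p

theorem existsUnique_teich (u : (ZMod (q p))ˣ) :
    ∃! ξ : ℤ_[p]ˣ, ξ ^ (q p).totient = 1 ∧
      Units.map (PadicInt.toZModPow (p := p) (qExp p) : ℤ_[p] →* ZMod (q p)) ξ = u := by
  refine existsUnique_teich_aux p (qExp p) ?_ u
  unfold qExp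
  split_ifs with h
  · exact Or.inl ⟨h, rfl⟩
  · exact Or.inr ⟨h, rfl⟩

/-- The Teichmüller lift `(ℤ/q)ˣ → ℤ_pˣ`: the roots of unity of `ℤ_p` are exactly those of
order dividing `φ(q)`, and `teich u` is the one whose class modulo `q` is `u`. -/
def teich : (ZMod (q p))ˣ →* ℤ_[p]ˣ where
  toFun u := (existsUnique_teich p u).choose
  map_one' := ((existsUnique_teich p 1).choose_spec.2 1 ⟨by simp, by simp⟩).symm
  map_mul' u v := by
    obtain ⟨⟨h1, h2⟩, -⟩ := (existsUnique_teich p u).choose_spec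
    obtain ⟨⟨h3, h4⟩, -⟩ := (existsUnique_teich p v).choose_spec
    refine ((existsUnique_teich p (u * v)).choose_spec.2 _ ⟨?_, ?_⟩).symm
    · rw [mul_pow, h1, h3, one_mul]
    · rw [map_mul, h2, h4]

/-- `θ(a)`, the root of unity of `ℤ_p` congruent to `a` modulo `q`. -/
def theta : ℤ_[p]ˣ →* ℤ_[p]ˣ :=
  (teich p).comp (Units.map (PadicInt.toZModPow (p := p) (qExp p) : ℤ_[p] →* ZMod (q p)))

/-- `⟨a⟩ = a θ(a)⁻¹`. -/
def angle (a : ℤ_[p]ˣ) : ℤ_[p]ˣ := a * (theta p a)⁻¹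

theorem tendsto_angle_sub_one_pow (a : ℤ_[p]ˣ) :
    Filter.Tendsto (fun n : ℕ => ((angle p a : ℤ_[p]) - 1) ^ n) Filter.atTop (𝓝 0) := by
  rw [tendsto_pow_atTop_nhds_zero_iff_norm_lt_one, PadicInt.norm_lt_one_iff_dvd]
  have h1 := (existsUnique_teich p (Units.map
    (PadicInt.toZModPow (p := p) (qExp p) : ℤ_[p] →* ZMod (q p)) a)).choose_spec.1.2
  have h2 : Units.map (PadicInt.toZModPow (p := p) (qExp p) : ℤ_[p] →* ZMod (q p))
      (theta p a) = Units.map (PadicInt.toZModPow (p := p) (qExp p) : ℤ_[p] →* ZMod (q p)) a := h1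
  have h3 : Units.map (PadicInt.toZModPow (p := p) (qExp p) : ℤ_[p] →* ZMod (q p))
      (angle p a) = 1 := by
    rw [angle, map_mul, map_inv, h2, mul_inv_cancel]
  have h4 : PadicInt.toZModPow (p := p) (qExp p) ((angle p a : ℤ_[p]) - 1) = 0 := by
    rw [map_sub, map_one, sub_eq_zero]
    simpa using congrArg Units.val h3
  rw [← RingHom.mem_ker, PadicInt.ker_toZModPow, Ideal.mem_span_singleton] at h4
  refine (dvd_pow_self _ ?_).trans h4
  unfold qExp
  split_ifs <;> decide

/-- The power `⟨a⟩ ^ s`, `s ∈ ℤ_p`, i.e. `∑_k (s choose k) (⟨a⟩ - 1) ^ k`. -/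
def anglePow (a : ℤ_[p]ˣ) (s : ℤ_[p]) : ℤ_[p] :=
  PadicInt.addChar_of_value_at_one ((angle p a : ℤ_[p]) - 1) (tendsto_angle_sub_one_pow p a) s

/-- An integer prime to `p`, as a unit of `ℤ_p` (and `1` for the other integers). -/
def toUnit (a : ℤ) : ℤ_[p]ˣ :=
  open Classical in if h : IsUnit (a : ℤ_[p]) then h.unit else 1

/-- `a⁻¹ ⟨a⟩ ^ (1 - s) ∈ ℤ_p`, for an integer `a` prime to `p`. -/
def weight (s : ℤ_[p]) (a : ℤ) : ℤ_[p] :=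
  ((toUnit p a)⁻¹ : ℤ_[p]ˣ) * anglePow p (toUnit p a) (1 - s)

/-- The embedding of `ℤ_p` into `ℂ_p`. -/
def toCp : ℤ_[p] →+* ℂ_[p] := (algebraMap ℚ_[p] ℂ_[p]).comp PadicInt.Coe.ringHom

/-! ### The tower `L_n = K(μ_{q p^n})` and the Mellin transform -/

/-- The modulus `q p ^ n`. -/
abbrev level (n : ℕ) : ℕ := p ^ (qExp p + n)

/-- `L_n = K(μ_{q p^n})`. -/
abbrev tower (K : IntermediateField ℚ QBar) (n : ℕ) : IntermediateField ℚ QBar :=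
  K ⊔ cyclo (level p n)

set_option linter.unusedSectionVars false in
theorem level_dvd (n : ℕ) : level p n ∣ level p (n + 1) := pow_dvd_pow p (by omega)

theorem tower_le (K : IntermediateField ℚ QBar) (n : ℕ) : tower p K n ≤ tower p K (n + 1) :=
  sup_le_sup_left (cyclo_mono (level_dvd p n)) K

variable (K : IntermediateField ℚ QBar) [IsAbelianField K]

/-- An integer `a`, prime to the conductor of `L_n`, such that `σ = (L_n/a)`. -/
def artinRep (n : ℕ) (σ : Gal(tower p K n/ℚ)) : ℤ :=
  Classical.epsilon fun a : ℤ =>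
    IsCoprime a (conductor (tower p K n) : ℤ) ∧ artinSymbol (tower p K n) a = σ

/-- The Mellin transform on `A_n = (ℤ_p / q p^n ℤ_p)[Gal(L_n/ℚ)]`: the linear map such that
`σ = (L_n/a) ↦ θ(a) ⟨a⟩ ^ s σ⁻¹`. -/
def mellin (s : ℤ_[p]) (n : ℕ) (x : MonoidAlgebra (ZMod (level p n)) Gal(tower p K n/ℚ)) :
    MonoidAlgebra (ZMod (level p n)) Gal(tower p K n/ℚ) :=
  x.coeff.sum fun σ r => MonoidAlgebra.single σ⁻¹
    (r * PadicInt.toZModPow (qExp p + n)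
      ((theta p (toUnit p (artinRep p K n σ)) : ℤ_[p]) *
        anglePow p (toUnit p (artinRep p K n σ)) s))

/-- The Mellin transform of an element of `ℤ[Gal(L_n/ℚ)]`, seen in `A_n`. -/
def mellinInt (s : ℤ_[p]) (n : ℕ) (x : MonoidAlgebra ℤ Gal(tower p K n/ℚ)) :
    MonoidAlgebra (ZMod (level p n)) Gal(tower p K n/ℚ) :=
  mellin p K s n (MonoidAlgebra.mapRingHom _ (Int.castRingHom (ZMod (level p n))) x)

/-! ### Dirichlet characters of `K` and their `p`-adic `L`-functions -/

/-- The Dirichlet character `χ` modulo `N` is a character of `K`: seen as a character of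
`Gal(ℚ(μ_N)/ℚ) = (ℤ/N)ˣ`, hence of the absolute Galois group of `ℚ`, it is trivial on the
automorphisms fixing `K`. -/
def IsCharacterOf {N : ℕ} (χ : DirichletCharacter ℂ_[p] N) : Prop :=
  ∀ σ : Gal(QBar/ℚ), (∀ x ∈ K, σ x = x) →
    ∀ a : ℤ, IsCoprime a (N : ℤ) → (∀ ζ : QBar, ζ ^ N = 1 → σ ζ = ζ ^ a) → χ a = 1

/-- `θ` as a Dirichlet character modulo `q` with values in `ℂ_p`. -/
def thetaChar : DirichletCharacter ℂ_[p] (q p) :=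
  MulChar.ofUnitHom ((Units.map (toCp p : ℤ_[p] →* ℂ_[p])).comp (teich p))

variable {p} in
/-- The primitive Dirichlet character attached to `χ θ^{-m}`. -/
def twistChar {N : ℕ} (χ : DirichletCharacter ℂ_[p] N) (m : ℕ) :
    DirichletCharacter ℂ_[p] (χ.mul ((thetaChar p)⁻¹ ^ m)).conductor :=
  χ.primitive_mul ((thetaChar p)⁻¹ ^ m)

instance {N : ℕ} [NeZero N] (χ : DirichletCharacter ℂ_[p] N) (m : ℕ) :
    NeZero (χ.mul ((thetaChar p)⁻¹ ^ m)).conductor := by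
  have : NeZero (N.lcm (q p)) :=
    ⟨Nat.lcm_ne_zero (NeZero.ne N) (pow_ne_zero _ (Fact.out : p.Prime).ne_zero)⟩
  exact ⟨DirichletCharacter.conductor_ne_zero _⟩

variable {p} in
/-- `L` is the Kubota-Leopoldt `p`-adic `L`-function of the primitive Dirichlet character `χ`
(values in `ℂ_p`, compared with complex numbers by the embedding `ι`): it is continuous on `ℤ_p`,
except at `s = 1` for the trivial character, and satisfies
`L(1 - m) = (1 - χθ^{-m}(p) p^{m-1}) L_ℂ(1 - m, χθ^{-m})` for all integers `m ≥ 1`.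
For `m` divisible by `φ(q)` one has `χθ^{-m} = χ`. -/
structure IsPadicLFunction (ι : ℂ_[p] →+* ℂ) {N : ℕ} [NeZero N] (χ : DirichletCharacter ℂ_[p] N)
    (L : ℤ_[p] → ℂ_[p]) : Prop where
  continuousOn : ContinuousOn L {s | χ ≠ 1 ∨ s ≠ 1}
  interpolation : ∀ m : ℕ, 1 ≤ m →
    ι (L (1 - m)) = (1 - ι (twistChar χ m p) * (p : ℂ) ^ (m - 1)) *
      DirichletCharacter.LFunction ((twistChar χ m).ringHomComp ι) (1 - m)

variable {p} in
/-- The sum `∑_a [λ_a^n(c) + (1 - c)/2] a⁻¹ ⟨a⟩ ^ (1 - s) χ(a)` over the integers `a ∈ [1, f_n]`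
prime to the conductor `f_n` of `L_n`. -/
def approxSum (c : ℤ) {N : ℕ} (χ : DirichletCharacter ℂ_[p] N) (s : ℤ_[p]) (n : ℕ) : ℂ_[p] :=
  ∑ a ∈ primeTo (conductor (tower p K n)),
    (twistCoeff (conductor (tower p K n)) c a : ℂ_[p]) * toCp p (weight p s a) * χ (a : ZMod N)

variable {p} in
/-- The factor `1 - χ(c) ⟨c⟩ ^ (1 - s)`. -/
def twistFactor (c : ℤ) {N : ℕ} (χ : DirichletCharacter ℂ_[p] N) (s : ℤ_[p]) : ℂ_[p] :=
  1 - χ (c : ZMod N) * toCp p (anglePow p (toUnit p c) (1 - s))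

variable {p} in
/-- The product of the Euler factors `1 - χ(ℓ) ℓ⁻¹ ⟨ℓ⟩ ^ (1 - s)` over the primes `ℓ ≠ p` dividing
the conductor of `K` but not the conductor `N` of the primitive character `χ`. -/
def eulerProduct {N : ℕ} (χ : DirichletCharacter ℂ_[p] N) (s : ℤ_[p]) : ℂ_[p] :=
  ∏ l ∈ (conductor K).primeFactors.filter (fun l => l ≠ p ∧ ¬ l ∣ N),
    (1 - χ (l : ZMod N) * toCp p (weight p s l))

end padic

end

end StickelbergerMeasure

/-!
The Stickelberger elements of the fields `L_n = K(μ_{qp^n})` are Bernoulli distributions, and the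
twist by `c` turns them into a `p`-adic measure whose integrals are the values of `L_p(s, χ)`.

*The measure.* For a modulus `F` and `a` prime to `F`, the integer `λ_a(c) + (1 - c)/2` equals `c
B₁(a'_c/F) - B₁(a/F)` with `B₁(x) = x - 1/2`. As `a ↦ a'_c` permutes the classes prime to `F`
(`sum_aPrime`), this is the formula of the twisted Stickelberger element. The distribution relation
of `B₁` (`sum_stickelberger_primeTo`), tested on indicator functions of classes, shows that these
integers form a measure with values in any abelian group (`sum_twistCoeff_smul`). This one statement
gives the compatibility of the group ring elements in the tower, that of their Mellin transforms,
and the convergence of the sums `Σ_n(s)` with the stated error. What it needs from Galois theory is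
that the conductor of `L_n` is `lcm(f_K, qp^n)` (`conductor_tower`), that Artin symbols on `L_n`
determine integers modulo `qp^n` (`dvd_sub_of_artinSymbol_eq`), and that the conductor of `χ`
divides `f_K` (`dvd_conductor_of_isCharacterOf`); all follow from the irreducibility of the
cyclotomic polynomials, through `ℚ(μ_a) ∩ ℚ(μ_b) = ℚ(μ_{gcd(a, b)})` (`cyclo_inf_le`). The weight
`a⁻¹⟨a⟩^{1-s}` is `θ(a)⁻¹⟨a⟩^{-s}`, the value at `a⁻¹` of the character `mellinChar` of `ℤ_pˣ`.

*Interpolation.* At `s = 1 - m` the weight is `a^{m-1} θ(a)^{-m}`, so with `ψ = χθ^{-m}` the sum is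
`∑_a [λ_a + (1 - c)/2] a^{m-1} ψ(a)`. Raising `a'_c c = a + λ_a F` to the power `m` shows that it is
`(1 - ψ(c) c^m)` times `-(F^{m-1}/m) ∑_a ψ(a) B_m(a/F)` up to a multiple of `F` with bounded
denominator (`exists_norm_sum_sub_bernoulliValue_le`). The last sum, over `a` prime to `F`, is
exactly `L(1 - m, ψ)` deprived of its Euler factors at the primes dividing `F`
(`bernoulliValue_eq_LFunction_mul`), by the values of the Hurwitz zeta function at non-positive
integers; at `0` these are computed here, by the trapezoidal rule (`hurwitzZetaOdd_zero`).

*The `p`-adic `L`-function.* With the tower of moduli `lcm(N, qp^n)` the only Euler factor lost is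
that at `p`, and `L_p(s, χ)` is the limit of the sums divided by `1 - χ(c)⟨c⟩^{1-s}`, for any `c`
for which this does not vanish at `s`; such a `c` exists except at the pole
(`exists_twistFactor_ne_zero`). The quotients for different `c` agree at the integers `1 - m`, which
are dense in `ℤ_p`, hence everywhere. The same density argument gives the uniqueness of `L_p(s, χ)`
and identifies the limit for the tower of `K`.
-/

namespace StickelbergerMeasure

/-! ### The Galois action on roots of unity and conductors -/

instance : Algebra.IsAlgebraic ℚ QBar := by
  have h := AlgebraicClosure.isAlgebraic ℚ
  convert! h

instance : IsAlgClosure ℚ QBar := ⟨inferInstance, inferInstance⟩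

instance : Normal ℚ QBar := IsAlgClosure.normal ℚ QBar

instance : IsGalois ℚ QBar := ⟨⟩

theorem exists_isPrimitiveRoot {m : ℕ} (hm : 0 < m) : ∃ ζ : QBar, IsPrimitiveRoot ζ m := by
  have : NeZero m := ⟨hm.ne'⟩
  exact HasEnoughRootsOfUnity.exists_primitiveRoot QBar m

theorem isCyclotomicExtension_cyclo {m : ℕ} (hm : 0 < m) :
    IsCyclotomicExtension {m} ℚ (cyclo m) := by
  have hset : {b : QBar | ∃ n ∈ ({m} : Set ℕ), n ≠ 0 ∧ b ^ n = 1} = {ζ : QBar | ζ ^ m = 1} := by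
    ext; simp [hm.ne']
  have hc := IntermediateField.isCyclotomicExtension_adjoin_of_exists_isPrimitiveRoot {m} ℚ QBar
    (fun n _ hn0 => exists_isPrimitiveRoot (Nat.pos_of_ne_zero hn0))
  rwa [hset] at hc

theorem mem_cyclo {m : ℕ} {ζ : QBar} (h : ζ ^ m = 1) : ζ ∈ cyclo m :=
  IntermediateField.subset_adjoin ℚ _ h

theorem zpow_congr {ζ : QBar} {m : ℕ} (hm : 0 < m) (h : ζ ^ m = 1) {a b : ℤ}
    (hab : (m : ℤ) ∣ a - b) : ζ ^ a = ζ ^ b := by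
  have h0 : ζ ≠ 0 := by
    rintro rfl
    simp [hm.ne'] at h
  obtain ⟨k, hk⟩ := hab
  rw [show a = b + m * k by linarith, zpow_add₀ h0, zpow_mul, zpow_natCast, h, one_zpow, mul_one]

/-- Every class prime to `m` acts on `μ_m` through the absolute Galois group, because the
cyclotomic polynomials are irreducible over `ℚ`. -/
theorem exists_gal_zpow {m : ℕ} (hm : 0 < m) {a : ℤ} (ha : IsCoprime a (m : ℤ)) :
    ∃ σ : Gal(QBar/ℚ), ∀ ζ : QBar, ζ ^ m = 1 → σ ζ = ζ ^ a := by
  have : NeZero m := ⟨hm.ne'⟩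
  have hc := isCyclotomicExtension_cyclo hm
  have := isAbelianGalois_cyclo hm
  have hz := IsCyclotomicExtension.zeta_spec m ℚ (cyclo m)
  set z := IsCyclotomicExtension.zeta m ℚ (cyclo m)
  let k := (a % m).toNat
  have hk : (k : ℤ) = a % m := Int.toNat_of_nonneg (Int.emod_nonneg _ (by exact_mod_cast hm.ne'))
  have hka : (m : ℤ) ∣ k - a := ⟨-(a / m), by rw [hk]; linarith [Int.emod_add_mul_ediv a m]⟩
  have hkm : k.Coprime m := by
    rw [← Nat.isCoprime_iff_coprime]
    obtain ⟨l, hl⟩ := hka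
    rw [show (k : ℤ) = a + m * l by linarith]
    exact ha.add_mul_left_left l
  let τ : Gal(cyclo m/ℚ) := IsCyclotomicExtension.fromZetaAut (hz.pow_of_coprime k hkm)
    (Polynomial.cyclotomic.irreducible_rat hm)
  have hτ : τ z = z ^ k := IsCyclotomicExtension.fromZetaAut_spec _ _
  refine ⟨τ.liftNormal QBar, fun ζ hζ => ?_⟩
  obtain ⟨i, -, hi⟩ := hz.eq_pow_of_pow_eq_one (ξ := ⟨ζ, mem_cyclo hζ⟩) (Subtype.ext hζ)
  have hi' : ζ = (z : QBar) ^ i := congrArg Subtype.val hi.symm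
  have h1 : τ.liftNormal QBar z = (z : QBar) ^ k :=
    (τ.liftNormal_commutes QBar z).trans (congrArg Subtype.val hτ)
  rw [← zpow_congr hm hζ hka, zpow_natCast, hi', map_pow, h1, ← pow_mul, ← pow_mul, mul_comm]

theorem gal_eq_on_cyclo {m : ℕ} {σ τ : Gal(QBar/ℚ)} (h : ∀ ζ : QBar, ζ ^ m = 1 → σ ζ = τ ζ)
    {x : QBar} (hx : x ∈ cyclo m) : σ x = τ x := by
  induction hx using IntermediateField.adjoin_induction with
  | mem x hx => exact h x hx
  | algebraMap x => simp
  | add x y _ _ hx hy => simp [hx, hy]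
  | inv x _ hx => simp [hx]
  | mul x y _ _ hx hy => simp [hx, hy]

theorem exists_zpow_of_gal {m : ℕ} (hm : 0 < m) (σ : Gal(QBar/ℚ)) :
    ∃ a : ℤ, IsCoprime a (m : ℤ) ∧ ∀ ζ : QBar, ζ ^ m = 1 → σ ζ = ζ ^ a := by
  have : NeZero m := ⟨hm.ne'⟩
  obtain ⟨ζ, hζ⟩ := exists_isPrimitiveRoot hm
  have hσ : IsPrimitiveRoot (σ ζ) m := hζ.map_of_injective σ.injective
  obtain ⟨i, -, hi⟩ := hζ.eq_pow_of_pow_eq_one hσ.pow_eq_one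
  refine ⟨i, ?_, fun ξ hξ => ?_⟩
  · rw [Nat.isCoprime_iff_coprime]
    rw [← hi] at hσ
    exact (hζ.pow_iff_coprime hm i).1 hσ
  · obtain ⟨j, -, rfl⟩ := hζ.eq_pow_of_pow_eq_one hξ
    rw [map_pow, ← hi, zpow_natCast, ← pow_mul, ← pow_mul, mul_comm]

/-- Infinite Galois theory: an element fixed by all automorphisms that fix `L` lies in `L`. -/
theorem mem_of_forall_gal (L : IntermediateField ℚ QBar) {x : QBar}
    (h : ∀ σ : Gal(QBar/ℚ), (∀ y ∈ L, σ y = y) → σ x = x) : x ∈ L := by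
  rw [← InfiniteGalois.fixedField_fixingSubgroup L, IntermediateField.mem_fixedField_iff]
  intro σ hσ
  exact h σ fun y hy => (IntermediateField.mem_fixingSubgroup_iff _ _).1 hσ y hy

/-- Two cyclotomic fields meet in the cyclotomic field of the greatest common divisor: an
automorphism acting on roots of unity by `u ≡ 1 (mod gcd(a, b))` is the product of one fixing `μ_a`
and one fixing `μ_b`, by the Chinese remainder theorem. -/
theorem cyclo_inf_le {a b : ℕ} (ha : 0 < a) (hb : 0 < b) :
    cyclo a ⊓ cyclo b ≤ cyclo (a.gcd b) := by
  rintro x ⟨hxa, hxb⟩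
  refine mem_of_forall_gal _ fun σ hσ => ?_
  have hab : 0 < a.lcm b := Nat.lcm_pos ha hb
  obtain ⟨u, hu, hσu⟩ := exists_zpow_of_gal hab σ
  have hgcd : ((a.gcd b : ℕ) : ℤ) ∣ u - 1 := by
    obtain ⟨ζ, hζ⟩ := exists_isPrimitiveRoot (Nat.gcd_pos_of_pos_left b ha)
    have h1 := hσu ζ ((hζ.pow_eq_one_iff_dvd _).2 ((Nat.gcd_dvd_left a b).trans
      (Nat.dvd_lcm_left a b)))
    rw [hσ ζ (mem_cyclo hζ.pow_eq_one)] at h1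
    refine (hζ.zpow_eq_one_iff_dvd _).1 ?_
    have h0 : ζ ≠ 0 := hζ.ne_zero (Nat.gcd_pos_of_pos_left b ha).ne'
    rw [zpow_sub₀ h0, ← h1, zpow_one, div_self h0]
  -- `v` is congruent to `1` modulo `a` and to `u` modulo `b`
  obtain ⟨v, hva, hvb⟩ : ∃ v : ℤ, (a : ℤ) ∣ v - 1 ∧ (b : ℤ) ∣ v - u := by
    obtain ⟨k, hk⟩ := hgcd
    rw [Nat.gcd_eq_gcd_ab] at hk
    exact ⟨1 + a * (a.gcdA b * k), ⟨a.gcdA b * k, by ring⟩,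
      ⟨-(a.gcdB b * k), by linear_combination -hk⟩⟩
  have hvc : IsCoprime v (a.lcm b : ℤ) := by
    have h1 : IsCoprime v (a : ℤ) := by
      obtain ⟨k, hk⟩ := hva
      exact ⟨1, -k, by linear_combination hk⟩
    have h2 : IsCoprime v (b : ℤ) := by
      obtain ⟨k, hk⟩ := hvb
      have : IsCoprime u (b : ℤ) :=
        hu.of_isCoprime_of_dvd_right (Int.natCast_dvd_natCast.2 (Nat.dvd_lcm_right a b))
      rw [show v = u + b * k by linarith]
      exact this.add_mul_left_left k
    exact (h1.mul_right h2).of_isCoprime_of_dvd_right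
      (by exact_mod_cast Nat.lcm_dvd_mul a b)
  obtain ⟨τ, hτ⟩ := exists_gal_zpow hab hvc
  have hroot {d : ℕ} (hd : d ∣ a.lcm b) {ζ : QBar} (h : ζ ^ d = 1) : ζ ^ a.lcm b = 1 := by
    obtain ⟨k, hk⟩ := hd
    rw [hk, pow_mul, h, one_pow]
  have h1 : τ x = (1 : Gal(QBar/ℚ)) x := by
    refine gal_eq_on_cyclo (fun ζ hζ => ?_) hxa
    rw [hτ ζ (hroot (Nat.dvd_lcm_left a b) hζ), zpow_congr ha hζ hva, zpow_one]
    rfl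
  have h2 : τ x = σ x := by
    refine gal_eq_on_cyclo (fun ζ hζ => ?_) hxb
    have h := hroot (Nat.dvd_lcm_right a b) hζ
    rw [hτ ζ h, hσu ζ h, zpow_congr hb hζ hvb]
  exact h2.symm.trans h1

theorem conductor_spec (L : IntermediateField ℚ QBar) [h : IsAbelianField L] :
    0 < conductor L ∧ L ≤ cyclo (conductor L) :=
  Nat.sInf_mem (s := {m : ℕ | 0 < m ∧ L ≤ cyclo m}) h.exists_le_cyclo

theorem le_cyclo_iff (L : IntermediateField ℚ QBar) [IsAbelianField L] {m : ℕ} (hm : 0 < m) :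
    L ≤ cyclo m ↔ conductor L ∣ m := by
  obtain ⟨h0, hL⟩ := conductor_spec L
  refine ⟨fun h => ?_, fun h => hL.trans (cyclo_mono h)⟩
  have h1 : conductor L ≤ (conductor L).gcd m :=
    Nat.sInf_le ⟨Nat.gcd_pos_of_pos_left m h0, (le_inf hL h).trans (cyclo_inf_le h0 hm)⟩
  have h2 := le_antisymm h1 (Nat.le_of_dvd h0 (Nat.gcd_dvd_left _ _))
  rw [h2]
  exact Nat.gcd_dvd_right _ _

/-- The condition `¬ (p = 2 ∧ k = 1)` excludes `ℚ(μ_2) = ℚ`. -/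
theorem dvd_of_cyclo_prime_pow_le {p k f : ℕ} (hp : p.Prime) (hk : k ≠ 0)
    (h2 : ¬ (p = 2 ∧ k = 1)) (hf : 0 < f) (h : cyclo (p ^ k) ≤ cyclo f) : p ^ k ∣ f := by
  have hpk : 0 < p ^ k := pow_pos hp.pos k
  obtain ⟨j, hj, hjk⟩ := (Nat.dvd_prime_pow hp).1 (Nat.gcd_dvd_left (p ^ k) f)
  rcases hj.eq_or_lt with rfl | hlt
  · rw [← hjk]; exact Nat.gcd_dvd_right _ _
  exfalso
  obtain ⟨k, rfl⟩ := Nat.exists_eq_succ_of_ne_zero hk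
  have hle : cyclo (p ^ (k + 1)) ≤ cyclo (p ^ k) :=
    (le_inf le_rfl h).trans ((cyclo_inf_le hpk hf).trans
      (hjk ▸ cyclo_mono (pow_dvd_pow p (Nat.lt_succ_iff.1 hlt))))
  -- `1 + p ^ k` is prime to `p` and fixes `μ_{p ^ k}` but not `μ_{p ^ (k + 1)}`
  have hcop : IsCoprime (1 + (p : ℤ) ^ k) ((p ^ (k + 1) : ℕ) : ℤ) := by
    rw [Nat.cast_pow]
    refine IsCoprime.pow_right ?_
    rcases Nat.eq_zero_or_pos k with rfl | hk0
    · have : Nat.Coprime 2 p := (Nat.coprime_primes Nat.prime_two hp).2 (by rintro rfl; simp at h2)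
      have := Nat.isCoprime_iff_coprime.2 this
      simpa using this
    · obtain ⟨l, rfl⟩ := Nat.exists_eq_succ_of_ne_zero hk0.ne'
      exact ⟨1, -p ^ l, by rw [Nat.succ_eq_add_one]; ring⟩
  obtain ⟨σ, hσ⟩ := exists_gal_zpow hpk hcop
  obtain ⟨ζ, hζ⟩ := exists_isPrimitiveRoot hpk
  have h1 : σ ζ = (1 : Gal(QBar/ℚ)) ζ := by
    refine gal_eq_on_cyclo (fun ξ hξ => ?_) (hle (mem_cyclo hζ.pow_eq_one))
    have : ξ ^ p ^ (k + 1) = 1 := by rw [pow_succ, pow_mul, hξ, one_pow]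
    rw [hσ ξ this, zpow_congr (pow_pos hp.pos k) hξ (b := 1) (by simp), zpow_one]
    rfl
  have h0 : ζ ≠ 0 := hζ.ne_zero hpk.ne'
  have h3 : ζ ^ (1 + (p : ℤ) ^ k) = ζ := (hσ ζ hζ.pow_eq_one).symm.trans h1
  rw [zpow_add₀ h0, zpow_one, mul_eq_left₀ h0, hζ.zpow_eq_one_iff_dvd] at h3
  have h4 : p ^ (k + 1) ∣ p ^ k := by exact_mod_cast h3
  exact absurd (Nat.le_of_dvd (pow_pos hp.pos k) h4)
    (not_le.2 (Nat.pow_lt_pow_right hp.one_lt (Nat.lt_succ_self k)))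

section tower

variable (p : ℕ)

theorem qExp_ne_zero : qExp p ≠ 0 := by
  unfold qExp; split_ifs <;> decide

variable [hp : Fact p.Prime]

theorem level_pos (n : ℕ) : 0 < level p n := pow_pos hp.out.pos _

theorem not_eq_two_and_qExp_add_eq_one (n : ℕ) : ¬ (p = 2 ∧ qExp p + n = 1) := by
  rintro ⟨rfl, h⟩
  simp [qExp] at h
  omega

/-- Besides `f_K`, the conductor of `K(μ_{qp^n})` is divisible by `qp^n` because `qp^n` is not
`2` modulo `4`. -/
theorem conductor_tower (K : IntermediateField ℚ QBar) [IsAbelianField K] (n : ℕ) :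
    conductor (tower p K n) = (conductor K).lcm (level p n) := by
  obtain ⟨h0, hL⟩ := conductor_spec (tower p K n)
  have hlcm : 0 < (conductor K).lcm (level p n) := Nat.lcm_pos (conductor_spec K).1 (level_pos p n)
  refine Nat.dvd_antisymm ?_ (Nat.lcm_dvd ?_ ?_)
  · rw [← le_cyclo_iff _ hlcm]
    exact sup_le ((le_cyclo_iff K hlcm).2 (Nat.dvd_lcm_left _ _))
      (cyclo_mono (Nat.dvd_lcm_right _ _))
  · rw [← le_cyclo_iff K h0]
    exact le_sup_left.trans hL
  · exact dvd_of_cyclo_prime_pow_le hp.out (by have := qExp_ne_zero p; omega)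
      (not_eq_two_and_qExp_add_eq_one p n) h0 (le_sup_right.trans hL)

end tower

/-! ### Artin symbols -/

theorem artinSymbol_eq {L : IntermediateField ℚ QBar} [IsAbelianField L] {m : ℕ}
    (hm : conductor L ∣ m) {σ : Gal(QBar/ℚ)} {a : ℤ} (hσ : ∀ ζ : QBar, ζ ^ m = 1 → σ ζ = ζ ^ a) :
    artinSymbol L a = AlgEquiv.restrictNormalHom L σ := by
  obtain ⟨k, hk⟩ := hm
  have h : ∃ σ : Gal(QBar/ℚ), ∀ ζ : QBar, ζ ^ conductor L = 1 → σ ζ = ζ ^ a :=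
    ⟨σ, fun ζ hζ => hσ ζ (by rw [hk, pow_mul, hζ, one_pow])⟩
  rw [artinSymbol, dif_pos h]
  ext x
  rw [AlgEquiv.restrictNormalHom_apply, AlgEquiv.restrictNormalHom_apply]
  refine gal_eq_on_cyclo (fun ζ hζ => ?_) ((conductor_spec L).2 x.2)
  rw [h.choose_spec ζ hζ, hσ ζ (by rw [hk, pow_mul, hζ, one_pow])]

theorem artinSymbol_mul {L : IntermediateField ℚ QBar} [IsAbelianField L] {a b : ℤ}
    (ha : IsCoprime a (conductor L : ℤ)) (hb : IsCoprime b (conductor L : ℤ)) :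
    artinSymbol L (a * b) = artinSymbol L a * artinSymbol L b := by
  obtain ⟨σ, hσ⟩ := exists_gal_zpow (conductor_spec L).1 ha
  obtain ⟨τ, hτ⟩ := exists_gal_zpow (conductor_spec L).1 hb
  rw [artinSymbol_eq dvd_rfl hσ, artinSymbol_eq dvd_rfl hτ, ← map_mul]
  refine artinSymbol_eq dvd_rfl fun ζ hζ => ?_
  rw [AlgEquiv.mul_apply, hτ ζ hζ, map_zpow₀, hσ ζ hζ, zpow_mul]

theorem artinSymbol_congr {L : IntermediateField ℚ QBar} [IsAbelianField L] {a b : ℤ}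
    (ha : IsCoprime a (conductor L : ℤ)) (h : (conductor L : ℤ) ∣ a - b) :
    artinSymbol L a = artinSymbol L b := by
  obtain ⟨σ, hσ⟩ := exists_gal_zpow (conductor_spec L).1 ha
  rw [artinSymbol_eq dvd_rfl hσ, artinSymbol_eq dvd_rfl (σ := σ) (a := b)]
  intro ζ hζ
  rw [hσ ζ hζ, zpow_congr (conductor_spec L).1 hζ h]

theorem artinSymbol_one (L : IntermediateField ℚ QBar) [IsAbelianField L] :
    artinSymbol L 1 = 1 := by
  rw [artinSymbol_eq dvd_rfl (σ := 1) (a := 1) (by simp), map_one]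

theorem conductor_dvd_of_le {L M : IntermediateField ℚ QBar} [IsAbelianField L] [IsAbelianField M]
    (h : L ≤ M) : conductor L ∣ conductor M :=
  (le_cyclo_iff L (conductor_spec M).1).1 (h.trans (conductor_spec M).2)

theorem restrictGal_apply {L M : IntermediateField ℚ QBar} [IsAbelianField L] (h : L ≤ M)
    (τ : Gal(M/ℚ)) (x : L) :
    ((restrictGal h τ x : L) : QBar) = τ (IntermediateField.inclusion h x) := by
  let _ : Algebra L M := (IntermediateField.inclusion h).toRingHom.toAlgebra
  have : IsScalarTower ℚ L M := IsScalarTower.of_algebraMap_eq fun _ => rfl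
  exact congrArg Subtype.val (AlgEquiv.restrictNormal_commutes τ L x)

theorem restrictGal_artinSymbol {L M : IntermediateField ℚ QBar} [IsAbelianField L]
    [IsAbelianField M] (h : L ≤ M) {a : ℤ} (ha : IsCoprime a (conductor M : ℤ)) :
    restrictGal h (artinSymbol M a) = artinSymbol L a := by
  obtain ⟨σ, hσ⟩ := exists_gal_zpow (conductor_spec M).1 ha
  rw [artinSymbol_eq dvd_rfl hσ, artinSymbol_eq (conductor_dvd_of_le h) hσ]
  ext x
  rw [restrictGal_apply, AlgEquiv.restrictNormalHom_apply, AlgEquiv.restrictNormalHom_apply]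
  rfl

/-- A field containing `μ_m` has Artin symbols that determine the integer modulo `m`. -/
theorem dvd_sub_of_artinSymbol_eq {L : IntermediateField ℚ QBar} [IsAbelianField L] {m : ℕ}
    (hm : 0 < m) (hL : cyclo m ≤ L) (hmc : m ∣ conductor L) {a b : ℤ}
    (ha : IsCoprime a (conductor L : ℤ)) (hb : IsCoprime b (conductor L : ℤ))
    (h : artinSymbol L a = artinSymbol L b) : (m : ℤ) ∣ a - b := by
  obtain ⟨σ, hσ⟩ := exists_gal_zpow (conductor_spec L).1 ha
  obtain ⟨τ, hτ⟩ := exists_gal_zpow (conductor_spec L).1 hb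
  obtain ⟨ζ, hζ⟩ := exists_isPrimitiveRoot hm
  have hζ' : ζ ^ conductor L = 1 := (hζ.pow_eq_one_iff_dvd _).2 hmc
  rw [artinSymbol_eq dvd_rfl hσ, artinSymbol_eq dvd_rfl hτ] at h
  have h1 := congrArg (fun g : Gal(L/ℚ) => ((g ⟨ζ, hL (mem_cyclo hζ.pow_eq_one)⟩ : L) : QBar)) h
  simp only [AlgEquiv.restrictNormalHom_apply] at h1
  rw [hσ ζ hζ', hτ ζ hζ'] at h1
  have h0 : ζ ≠ 0 := hζ.ne_zero hm.ne'
  rw [← hζ.zpow_eq_one_iff_dvd, zpow_sub₀ h0, h1, div_self (zpow_ne_zero _ h0)]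

/-- The conductor of a primitive Dirichlet character of `K` divides the conductor of `K`: the
character factors through the greatest common divisor of the two. -/
theorem dvd_conductor_of_isCharacterOf {p : ℕ} [Fact p.Prime] {K : IntermediateField ℚ QBar}
    [IsAbelianField K] {N : ℕ} [NeZero N] {χ : DirichletCharacter ℂ_[p] N} (hχ : χ.IsPrimitive)
    (hK : IsCharacterOf p K χ) : N ∣ conductor K := by
  obtain ⟨h0, hKc⟩ := conductor_spec K
  have hfac : χ.FactorsThrough (N.gcd (conductor K)) := by
    rw [DirichletCharacter.factorsThrough_iff_ker_unitsMap (Nat.gcd_dvd_left _ _)]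
    intro u hu
    rw [MonoidHom.mem_ker] at hu ⊢
    obtain ⟨a, ha⟩ : ∃ a : ℤ, (a : ZMod N) = u := ZMod.intCast_surjective _
    have hac : IsCoprime a (N : ℤ) :=
      ((ZMod.coe_int_isUnit_iff_isCoprime a N).1 (ha ▸ u.isUnit)).symm
    have hg : ((N.gcd (conductor K) : ℕ) : ℤ) ∣ a - 1 := by
      have h1 := congrArg Units.val hu
      rw [ZMod.unitsMap_val, ← ha, ZMod.cast_intCast (Nat.gcd_dvd_left _ _), Units.val_one,
        ← Int.cast_one, eq_comm, ZMod.intCast_eq_intCast_iff_dvd_sub] at h1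
      exact h1
    obtain ⟨k, hk⟩ := hg
    rw [Nat.gcd_eq_gcd_ab] at hk
    -- `b` is congruent to `a` modulo `N` and to `1` modulo the conductor of `K`
    set b : ℤ := 1 + conductor K * (N.gcdB (conductor K) * k) with hb
    have hba : b - a = N * (-(N.gcdA (conductor K) * k)) := by rw [hb]; linear_combination -hk
    have hbN : IsCoprime b (N : ℤ) := by
      rw [show b = a + N * (-(N.gcdA (conductor K) * k)) by linarith]
      exact hac.add_mul_left_left _
    have hbK : IsCoprime b (conductor K : ℤ) := ⟨1, -(N.gcdB (conductor K) * k), by rw [hb]; ring⟩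
    obtain ⟨σ, hσ⟩ := exists_gal_zpow (Nat.lcm_pos (NeZero.pos N) h0) (a := b)
      ((hbN.mul_right hbK).of_isCoprime_of_dvd_right (by exact_mod_cast Nat.lcm_dvd_mul _ _))
    have hroot {d : ℕ} (hd : d ∣ N.lcm (conductor K)) {ζ : QBar} (h : ζ ^ d = 1) :
        ζ ^ N.lcm (conductor K) = 1 := by
      obtain ⟨k, hk⟩ := hd
      rw [hk, pow_mul, h, one_pow]
    have h1 := hK σ (fun x hx => ?_) b hbN fun ζ hζ => hσ ζ (hroot (Nat.dvd_lcm_left _ _) hζ)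
    · have h2 : (b : ZMod N) = u := by
        rw [← ha, eq_comm, ZMod.intCast_eq_intCast_iff_dvd_sub]
        exact ⟨_, hba⟩
      rw [h2] at h1
      ext
      rw [MulChar.coe_toUnitHom, h1, Units.val_one]
    · refine (gal_eq_on_cyclo (τ := 1) (fun ζ hζ => ?_) (hKc hx))
      rw [hσ ζ (hroot (Nat.dvd_lcm_right _ _) hζ),
        zpow_congr h0 hζ (b := 1) ⟨_, by rw [hb, add_sub_cancel_left]⟩, zpow_one]
      rfl
  have h1 := DirichletCharacter.conductor_dvd_of_mem_conductorSet (χ := χ) hfac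
  rw [hχ] at h1
  exact h1.trans (Nat.gcd_dvd_right _ _)

/-! ### Twisted coefficients and their distribution relation -/

theorem mem_primeTo {f a : ℕ} : a ∈ primeTo f ↔ (1 ≤ a ∧ a ≤ f) ∧ a.Coprime f := by
  simp [primeTo]

theorem isCoprime_of_mem_primeTo {f a : ℕ} (h : a ∈ primeTo f) : IsCoprime (a : ℤ) (f : ℤ) :=
  Nat.isCoprime_iff_coprime.2 (mem_primeTo.1 h).2

theorem eq_of_natCast_eq_of_mem_primeTo {f a b : ℕ} (ha : a ∈ primeTo f) (hb : b ∈ primeTo f)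
    (h : (a : ZMod f) = b) : a = b := by
  obtain ⟨⟨ha1, ha2⟩, -⟩ := mem_primeTo.1 ha
  obtain ⟨⟨hb1, hb2⟩, -⟩ := mem_primeTo.1 hb
  have h1 : (f : ℤ) ∣ (b : ℤ) - a := by
    rw [← ZMod.intCast_eq_intCast_iff_dvd_sub]
    exact_mod_cast h
  have h2 : (b : ℤ) - a = 0 := Int.eq_zero_of_abs_lt_dvd h1 (by rw [abs_lt]; omega)
  omega

section

variable {f : ℕ} {c : ℤ}

theorem aPrime_spec (hf : 0 < f) (hc : IsCoprime c (f : ℤ)) (a : ℕ) :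
    1 ≤ aPrime f c a ∧ aPrime f c a ≤ f ∧ (f : ℤ) ∣ aPrime f c a * c - a := by
  refine Nat.sInf_mem (s := {b : ℕ | 1 ≤ b ∧ b ≤ f ∧ (f : ℤ) ∣ b * c - a}) ?_
  have hf' : (f : ℤ) ≠ 0 := by exact_mod_cast hf.ne'
  obtain ⟨u, v, huv⟩ := hc
  have h0 := Int.emod_nonneg (a * u - 1) hf'
  have h1 := Int.emod_lt_of_pos (a * u - 1) (by exact_mod_cast hf : (0 : ℤ) < f)
  have h2 := Int.emod_add_mul_ediv (a * u - 1) f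
  refine ⟨((a * u - 1) % f).toNat + 1, by omega, by omega, ?_⟩
  rw [Nat.cast_add, Int.toNat_of_nonneg h0]
  refine ⟨-(((a * u - 1) / f) * c) - a * v, ?_⟩
  push_cast
  linear_combination c * h2 + a * huv

theorem aPrime_mul (hf : 0 < f) (hc : IsCoprime c (f : ℤ)) (a : ℕ) :
    (c : ZMod f) * (aPrime f c a : ZMod f) = a := by
  have h := (aPrime_spec hf hc a).2.2
  have : ((a : ℤ) : ZMod f) = ((aPrime f c a * c : ℤ) : ZMod f) :=
    (ZMod.intCast_eq_intCast_iff_dvd_sub _ _ _).2 h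
  push_cast at this
  rw [this, mul_comm]

theorem aPrime_mem (hf : 0 < f) (hc : IsCoprime c (f : ℤ)) {a : ℕ} (ha : a ∈ primeTo f) :
    aPrime f c a ∈ primeTo f := by
  obtain ⟨h1, h2, k, hk⟩ := aPrime_spec hf hc a
  refine mem_primeTo.2 ⟨⟨h1, h2⟩, ?_⟩
  rw [← Nat.isCoprime_iff_coprime]
  have h3 : IsCoprime (aPrime f c a * c : ℤ) (f : ℤ) := by
    rw [show (aPrime f c a * c : ℤ) = a + f * k by linarith]
    exact (isCoprime_of_mem_primeTo ha).add_mul_left_left k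
  exact h3.of_mul_left_left

/-- The map `a ↦ a'_c` permutes the integers of `[1, f]` prime to `f`. -/
theorem sum_aPrime {M : Type*} [AddCommMonoid M] (hf : 0 < f) (hc : IsCoprime c (f : ℤ))
    (g : ℕ → ZMod f → M) :
    ∑ a ∈ primeTo f, g (aPrime f c a) a = ∑ a ∈ primeTo f, g a (c * a) := by
  have hinj : Set.InjOn (aPrime f c) (primeTo f) := fun a ha b hb h => by
    refine eq_of_natCast_eq_of_mem_primeTo ha hb ?_
    rw [← aPrime_mul hf hc a, ← aPrime_mul hf hc b, h]
  have himage : (primeTo f).image (aPrime f c) = primeTo f :=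
    Finset.eq_of_subset_of_card_le
      (Finset.image_subset_iff.2 fun a ha => aPrime_mem hf hc ha)
      (Finset.card_image_of_injOn hinj).ge
  conv_rhs => rw [← himage]
  rw [Finset.sum_image hinj]
  refine Finset.sum_congr rfl fun a _ => ?_
  rw [aPrime_mul hf hc]

theorem lam_mul (hf : 0 < f) (hc : IsCoprime c (f : ℤ)) (a : ℕ) :
    lam f c a * f = aPrime f c a * c - a :=
  Int.ediv_mul_cancel (aPrime_spec hf hc a).2.2

theorem twistCoeff_eq (hf : 0 < f) (hc : IsCoprime c (f : ℤ)) (hodd : Odd c) (a : ℕ) :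
    (twistCoeff f c a : ℚ) =
      c * ((aPrime f c a : ℚ) / f - 1 / 2) - ((a : ℚ) / f - 1 / 2) := by
  have hf' : (f : ℚ) ≠ 0 := by exact_mod_cast hf.ne'
  have h1 : (lam f c a : ℚ) * f = aPrime f c a * c - a := by exact_mod_cast lam_mul hf hc a
  have h2 : (((1 - c) / 2 : ℤ) : ℚ) = (1 - c) / 2 := by
    rw [Int.cast_div _ (by norm_num)]
    · norm_num
    · obtain ⟨k, rfl⟩ := hodd
      exact ⟨-k, by ring⟩
  have h3 : (lam f c a : ℚ) = (aPrime f c a * c - a) / f := by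
    rw [← h1]; field_simp
  rw [twistCoeff, Int.cast_add, h2, h3]
  field_simp
  ring

end

theorem sum_primeTo_mul {M : Type*} [AddCommMonoid M] {f d : ℕ} (hf : 0 < f)
    (hfd : ∀ a : ℕ, a.Coprime f → a.Coprime (f * d)) (g : ℕ → M) :
    ∑ a ∈ primeTo (f * d), g a = ∑ b ∈ primeTo f, ∑ i ∈ Finset.range d, g (b + i * f) := by
  rw [← Finset.sum_product']
  symm
  refine Finset.sum_bij' (fun x _ => x.1 + x.2 * f)
    (fun a _ => ((a - 1) % f + 1, (a - 1) / f)) ?_ ?_ ?_ ?_ ?_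
  · rintro ⟨b, i⟩ h
    obtain ⟨hb, hi⟩ := Finset.mem_product.1 h
    obtain ⟨⟨h1, h2⟩, h3⟩ := mem_primeTo.1 hb
    have hi' : i + 1 ≤ d := Finset.mem_range.1 hi
    refine mem_primeTo.2 ⟨⟨by dsimp only; omega, ?_⟩, hfd _ (by simpa using h3)⟩
    have h4 := Nat.mul_le_mul_left f hi'
    dsimp only at h1 h2 ⊢
    nlinarith
  · intro a ha
    obtain ⟨⟨h1, h2⟩, h3⟩ := mem_primeTo.1 ha
    have h4 := Nat.mod_lt (a - 1) hf
    have h5 := Nat.mod_add_div (a - 1) f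
    refine Finset.mem_product.2 ⟨mem_primeTo.2 ⟨⟨by dsimp only; omega, by dsimp only; omega⟩, ?_⟩,
      Finset.mem_range.2 ?_⟩
    · have h6 : a = (a - 1) % f + 1 + f * ((a - 1) / f) := by omega
      have h7 := h3.coprime_mul_right_right
      rw [h6] at h7
      simpa using h7
    · exact Nat.div_lt_of_lt_mul (by omega)
  · rintro ⟨b, i⟩ h
    obtain ⟨⟨h1, h2⟩, h3⟩ := mem_primeTo.1 (Finset.mem_product.1 h).1
    dsimp only at h1 h2 ⊢
    have h4 : b + i * f - 1 = (b - 1) + f * i := by rw [mul_comm f i]; omega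
    rw [h4, Nat.add_mul_mod_self_left, Nat.add_mul_div_left _ _ hf, Nat.mod_eq_of_lt (by omega),
      Nat.div_eq_of_lt (by omega)]
    ext <;> dsimp only <;> omega
  · intro a ha
    obtain ⟨⟨h1, h2⟩, h3⟩ := mem_primeTo.1 ha
    have h5 := Nat.mod_add_div (a - 1) f
    dsimp only
    rw [mul_comm ((a - 1) / f) f]
    omega
  · rintro ⟨b, i⟩ _
    rfl

section

variable {f f' : ℕ} {c : ℤ}

/-- The distribution relation of the first Bernoulli polynomial `x - 1/2`. -/
theorem sum_stickelberger_primeTo (hf' : 0 < f') (hdvd : f ∣ f')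
    (hcop : ∀ a : ℕ, a.Coprime f → a.Coprime f') (h : ZMod f → ℚ) :
    ∑ a ∈ primeTo f', ((a : ℚ) / f' - 1 / 2) * h a =
      ∑ a ∈ primeTo f, ((a : ℚ) / f - 1 / 2) * h a := by
  obtain ⟨d, rfl⟩ := hdvd
  have hf : 0 < f := Nat.pos_of_mul_pos_right hf'
  have hd : 0 < d := Nat.pos_of_mul_pos_left hf'
  rw [sum_primeTo_mul hf hcop]
  refine Finset.sum_congr rfl fun b _ => ?_
  have hfq : (f : ℚ) ≠ 0 := by exact_mod_cast hf.ne'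
  have hdq : (d : ℚ) ≠ 0 := by exact_mod_cast hd.ne'
  have hgauss : ∑ i ∈ Finset.range d, (i : ℚ) = d * (d - 1) / 2 := by
    have h1 : (∑ i ∈ Finset.range d, (i : ℚ)) * 2 = d * ((d - 1 : ℕ) : ℚ) := by
      rw [← Nat.cast_mul, ← Finset.sum_range_id_mul_two, Nat.cast_mul, Nat.cast_sum, Nat.cast_two]
    rw [Nat.cast_sub hd, Nat.cast_one] at h1
    linarith
  calc ∑ i ∈ Finset.range d, (((b + i * f : ℕ) : ℚ) / (f * d : ℕ) - 1 / 2) * h ((b + i * f : ℕ))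
      = ∑ i ∈ Finset.range d, ((b : ℚ) / (f * d) - 1 / 2 + i / d) * h b := by
        refine Finset.sum_congr rfl fun i _ => ?_
        push_cast
        rw [CharP.cast_eq_zero (ZMod f) f, mul_zero, add_zero]
        congr 1
        field_simp
        ring
    _ = ((b : ℚ) / f - 1 / 2) * h b := by
        rw [← Finset.sum_mul, Finset.sum_add_distrib, Finset.sum_const, ← Finset.sum_div, hgauss,
          Finset.card_range, nsmul_eq_mul]
        congr 1
        field_simp
        ring

theorem sum_twistCoeff_mul (hf : 0 < f) (hc : IsCoprime c (f : ℤ)) (hodd : Odd c)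
    (h : ZMod f → ℚ) :
    ∑ a ∈ primeTo f, (twistCoeff f c a : ℚ) * h a =
      ∑ a ∈ primeTo f, ((a : ℚ) / f - 1 / 2) * (c * h (c * a) - h a) := by
  have h1 := sum_aPrime hf hc fun a x => c * ((a : ℚ) / f - 1 / 2) * h x
  calc ∑ a ∈ primeTo f, (twistCoeff f c a : ℚ) * h a
      = ∑ a ∈ primeTo f, c * ((aPrime f c a : ℚ) / f - 1 / 2) * h a -
          ∑ a ∈ primeTo f, ((a : ℚ) / f - 1 / 2) * h a := by
        rw [← Finset.sum_sub_distrib]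
        exact Finset.sum_congr rfl fun a _ => by rw [twistCoeff_eq hf hc hodd, sub_mul]
    _ = ∑ a ∈ primeTo f, ((a : ℚ) / f - 1 / 2) * (c * h (c * a) - h a) := by
        rw [h1, ← Finset.sum_sub_distrib]
        exact Finset.sum_congr rfl fun a _ => by ring

/-- The twisted coefficients form a measure: their sum over the classes modulo `f'` above a class
modulo `f` is the coefficient of the latter. -/
theorem sum_twistCoeff_smul {M : Type*} [AddCommGroup M] (hf' : 0 < f') (hdvd : f ∣ f')
    (hcop : ∀ a : ℕ, a.Coprime f → a.Coprime f') (hc : IsCoprime c (f' : ℤ)) (hodd : Odd c)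
    (h : ZMod f → M) :
    ∑ a ∈ primeTo f', twistCoeff f' c a • h a = ∑ a ∈ primeTo f, twistCoeff f c a • h a := by
  classical
  have hf : 0 < f := Nat.pos_of_dvd_of_pos hdvd hf'
  have : NeZero f := ⟨hf.ne'⟩
  have hcf : IsCoprime c (f : ℤ) := hc.of_isCoprime_of_dvd_right (Int.natCast_dvd_natCast.2 hdvd)
  have key (x : ZMod f) : ∑ a ∈ primeTo f' with ((a : ℕ) : ZMod f) = x, twistCoeff f' c a =
      ∑ a ∈ primeTo f with ((a : ℕ) : ZMod f) = x, twistCoeff f c a := by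
    let e : ZMod f → ℚ := fun y => if y = x then 1 else 0
    have h1 : ∑ a ∈ primeTo f', (twistCoeff f' c a : ℚ) * e a =
        ∑ a ∈ primeTo f, (twistCoeff f c a : ℚ) * e a := by
      have h2 := sum_twistCoeff_mul hf' hc hodd fun y => e (ZMod.castHom hdvd (ZMod f) y)
      simp only [map_natCast, map_mul, map_intCast] at h2
      rw [h2, sum_twistCoeff_mul hf hcf hodd,
        ← sum_stickelberger_primeTo hf' hdvd hcop fun y => c * e (c * y) - e y]
    rw [← Int.cast_inj (α := ℚ)]
    push_cast
    rw [Finset.sum_filter, Finset.sum_filter]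
    simpa [e] using h1
  rw [← Finset.sum_fiberwise (primeTo f') (fun a : ℕ => (a : ZMod f)),
    ← Finset.sum_fiberwise (primeTo f) (fun a : ℕ => (a : ZMod f))]
  refine Finset.sum_congr rfl fun x _ => ?_
  have h3 (s : Finset ℕ) (t : ℕ → ℤ) :
      ∑ a ∈ s with ((a : ℕ) : ZMod f) = x, t a • h a =
        (∑ a ∈ s with ((a : ℕ) : ZMod f) = x, t a) • h x := by
    rw [Finset.sum_smul]
    refine Finset.sum_congr rfl fun a ha => ?_
    rw [(Finset.mem_filter.1 ha).2]
  rw [h3, h3, key]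

end

/-! ### The weights `a⁻¹⟨a⟩^{1-s}` -/

section

variable {p : ℕ} [hp : Fact p.Prime]

theorem isUnit_intCast_iff {a : ℤ} : IsUnit (a : ℤ_[p]) ↔ IsCoprime a (p : ℤ) := by
  rw [PadicInt.isUnit_iff, ← not_iff_not]
  have h : ¬ ‖(a : ℤ_[p])‖ = 1 ↔ ‖(a : ℤ_[p])‖ < 1 :=
    ⟨fun h => lt_of_le_of_ne (PadicInt.norm_le_one _) h, fun h => h.ne⟩
  rw [h, PadicInt.norm_int_lt_one_iff_dvd, isCoprime_comm,
    (Nat.prime_iff_prime_int.1 hp.out).coprime_iff_not_dvd, not_not]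

theorem coe_toUnit {a : ℤ} (ha : IsCoprime a (p : ℤ)) : (toUnit p a : ℤ_[p]) = a := by
  rw [toUnit, dif_pos (isUnit_intCast_iff.2 ha), IsUnit.unit_spec]

theorem theta_eq_one {u : ℤ_[p]ˣ} (h : PadicInt.toZModPow (qExp p) (u : ℤ_[p]) = 1) :
    theta p u = 1 := by
  have h1 : Units.map (PadicInt.toZModPow (p := p) (qExp p) : ℤ_[p] →* ZMod (q p)) u = 1 :=
    Units.ext h
  rw [theta, MonoidHom.comp_apply, h1, map_one]

theorem angle_mul (u v : ℤ_[p]ˣ) : angle p (u * v) = angle p u * angle p v := by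
  rw [angle, angle, angle, map_mul, mul_inv, mul_mul_mul_comm]

theorem continuous_anglePow (u : ℤ_[p]ˣ) : Continuous (anglePow p u) :=
  PadicInt.continuous_addChar_of_value_at_one _

theorem anglePow_add (u : ℤ_[p]ˣ) (s t : ℤ_[p]) :
    anglePow p u (s + t) = anglePow p u s * anglePow p u t :=
  AddChar.map_add_eq_mul _ _ _

theorem anglePow_one_right (u : ℤ_[p]ˣ) : anglePow p u 1 = angle p u := by
  rw [anglePow, PadicInt.addChar_of_value_at_one_def, add_sub_cancel]

theorem anglePow_mul_natCast (u : ℤ_[p]ˣ) (t : ℤ_[p]) (n : ℕ) :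
    anglePow p u (t * n) = anglePow p u t ^ n := by
  rw [mul_comm, ← nsmul_eq_mul]
  exact AddChar.map_nsmul_eq_pow _ _ _

theorem anglePow_natCast (u : ℤ_[p]ˣ) (n : ℕ) : anglePow p u n = (angle p u : ℤ_[p]) ^ n := by
  rw [← one_mul (n : ℤ_[p]), anglePow_mul_natCast, anglePow_one_right]

theorem anglePow_mul_left (u v : ℤ_[p]ˣ) (s : ℤ_[p]) :
    anglePow p (u * v) s = anglePow p u s * anglePow p v s := by
  refine congrFun (PadicInt.denseRange_natCast.equalizer (continuous_anglePow _)
    ((continuous_anglePow u).mul (continuous_anglePow v)) (funext fun n => ?_)) s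
  simp [anglePow_natCast, angle_mul, mul_pow]

theorem toZModPow_eq_zero_iff {k : ℕ} {x : ℤ_[p]} :
    PadicInt.toZModPow k x = 0 ↔ ‖x‖ ≤ ‖((p ^ k : ℕ) : ℤ_[p])‖ := by
  rw [← RingHom.mem_ker, PadicInt.ker_toZModPow, ← PadicInt.norm_le_pow_iff_mem_span_pow,
    Nat.cast_pow, PadicInt.norm_p_pow]

theorem toZModPow_eq_iff {k : ℕ} {x y : ℤ_[p]} :
    PadicInt.toZModPow k x = PadicInt.toZModPow k y ↔ ‖x - y‖ ≤ ‖((p ^ k : ℕ) : ℤ_[p])‖ := by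
  rw [← toZModPow_eq_zero_iff, map_sub, sub_eq_zero]

theorem toZModPow_anglePow_eq_one {k : ℕ} {u : ℤ_[p]ˣ}
    (h : PadicInt.toZModPow k (angle p u : ℤ_[p]) = 1) (s : ℤ_[p]) :
    PadicInt.toZModPow k (anglePow p u s) = 1 := by
  rw [← map_one (PadicInt.toZModPow k), toZModPow_eq_iff]
  have hcl : IsClosed {t : ℤ_[p] | ‖anglePow p u t - 1‖ ≤ ‖((p ^ k : ℕ) : ℤ_[p])‖} :=
    isClosed_le ((continuous_anglePow u).sub continuous_const).norm continuous_const
  refine hcl.closure_subset_iff.2 ?_ (PadicInt.denseRange_natCast s)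
  rintro _ ⟨n, rfl⟩
  rw [Set.mem_ofPred_eq, ← toZModPow_eq_iff, anglePow_natCast, map_pow, h, one_pow, map_one]

variable (p) in
/-- The character `u ↦ θ(u)⟨u⟩^s` of `ℤ_pˣ` by which the Mellin transform twists. -/
noncomputable def mellinChar (s : ℤ_[p]) : ℤ_[p]ˣ →* ℤ_[p] where
  toFun u := theta p u * anglePow p u s
  map_one' := by
    have h : angle p 1 = 1 := by rw [angle, map_one, inv_one, one_mul]
    have h1 : anglePow p 1 s = 1 := by
      have := anglePow_mul_left (1 : ℤ_[p]ˣ) 1 s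
      have h2 : anglePow p 1 s * anglePow p 1 (1 - s) = 1 := by
        rw [← anglePow_add, add_sub_cancel, anglePow_one_right, h, Units.val_one]
      rw [mul_one] at this
      exact (mul_eq_left₀ (left_ne_zero_of_mul_eq_one h2)).1 this.symm
    rw [h1, map_one, Units.val_one, mul_one]
  map_mul' u v := by
    rw [map_mul, anglePow_mul_left, Units.val_mul, mul_mul_mul_comm]

/-- Modulo `qp^n` the character `θ(u)⟨u⟩^s` depends only on `u` modulo `qp^n`: a unit
`w ≡ 1 (mod qp^n)` has `θ(w) = 1`, and all powers `w^s` are congruent to `1`. -/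
theorem toZModPow_mellinChar {n : ℕ} {u v : ℤ_[p]ˣ} (s : ℤ_[p])
    (h : PadicInt.toZModPow (qExp p + n) (u : ℤ_[p]) =
      PadicInt.toZModPow (qExp p + n) (v : ℤ_[p])) :
    PadicInt.toZModPow (qExp p + n) (mellinChar p s u) =
      PadicInt.toZModPow (qExp p + n) (mellinChar p s v) := by
  set w := u * v⁻¹ with hw
  have hw1 : PadicInt.toZModPow (qExp p + n) (w : ℤ_[p]) = 1 := by
    rw [hw, Units.val_mul, map_mul, h, ← map_mul, Units.mul_inv, map_one]
  have hw2 : theta p w = 1 := by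
    refine theta_eq_one ?_
    rw [← PadicInt.zmod_cast_comp_toZModPow (p := p) (qExp p) (qExp p + n) (by omega),
      RingHom.comp_apply, hw1, map_one]
  have hw3 : angle p w = w := by rw [angle, hw2, inv_one, mul_one]
  have hu : u = w * v := by rw [hw, inv_mul_cancel_right]
  have hw4 : mellinChar p s w = anglePow p w s := by
    change (theta p w : ℤ_[p]) * anglePow p w s = _
    rw [hw2, Units.val_one, one_mul]
  rw [hu, map_mul, map_mul, hw4, toZModPow_anglePow_eq_one (by rw [hw3, hw1]), one_mul]

theorem weight_eq (s : ℤ_[p]) (a : ℤ) : weight p s a = mellinChar p s (toUnit p a)⁻¹ := by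
  set u := toUnit p a with hu
  have h1 : mellinChar p s u⁻¹ * mellinChar p s u = 1 := by
    rw [← map_mul, inv_mul_cancel, map_one]
  have h2 : weight p s a * mellinChar p s u = 1 := by
    change ((u⁻¹ : ℤ_[p]ˣ) : ℤ_[p]) * anglePow p u (1 - s) * (theta p u * anglePow p u s) = 1
    have h3 : anglePow p u (1 - s) * anglePow p u s = angle p u := by
      rw [← anglePow_add, sub_add_cancel, anglePow_one_right]
    have h4 : angle p u * theta p u = u := by rw [angle, inv_mul_cancel_right]
    calc _ = ((u⁻¹ : ℤ_[p]ˣ) : ℤ_[p]) * ((anglePow p u (1 - s) * anglePow p u s) * theta p u) := by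
          ring
      _ = 1 := by rw [h3, ← Units.val_mul, h4, Units.inv_mul]
  exact mul_right_cancel₀ (right_ne_zero_of_mul_eq_one h1) (h2.trans h1.symm)

theorem toZModPow_inv {k : ℕ} {u v : ℤ_[p]ˣ}
    (h : PadicInt.toZModPow k ((u * v : ℤ_[p]ˣ) : ℤ_[p]) = 1) :
    PadicInt.toZModPow k (u : ℤ_[p]) = PadicInt.toZModPow k ((v⁻¹ : ℤ_[p]ˣ) : ℤ_[p]) := by
  rw [← mul_one (PadicInt.toZModPow k ((v⁻¹ : ℤ_[p]ˣ) : ℤ_[p])), ← h, ← map_mul, ← Units.val_mul,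
    mul_comm u v, inv_mul_cancel_left]

theorem toZModPow_intCast_eq {k : ℕ} {a b : ℤ} (h : ((p ^ k : ℕ) : ℤ) ∣ a - b) :
    PadicInt.toZModPow k (a : ℤ_[p]) = PadicInt.toZModPow k (b : ℤ_[p]) := by
  rw [map_intCast, map_intCast, eq_comm, ZMod.intCast_eq_intCast_iff_dvd_sub]
  exact h

theorem toZModPow_weight {n : ℕ} {a b : ℤ} (s : ℤ_[p]) (ha : IsCoprime a (p : ℤ))
    (hb : IsCoprime b (p : ℤ)) (h : (level p n : ℤ) ∣ a - b) :
    PadicInt.toZModPow (qExp p + n) (weight p s a) =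
      PadicInt.toZModPow (qExp p + n) (weight p s b) := by
  rw [weight_eq, weight_eq]
  refine toZModPow_mellinChar s (toZModPow_inv ?_)
  rw [Units.val_mul, map_mul, coe_toUnit hb, ← toZModPow_intCast_eq h, ← coe_toUnit ha, ← map_mul,
    Units.inv_mul, map_one]

theorem continuous_weight (a : ℤ) : Continuous fun s => weight p s a :=
  continuous_const.mul ((continuous_anglePow _).comp (continuous_const.sub continuous_id))

theorem weight_one_sub {a : ℤ} (ha : IsCoprime a (p : ℤ)) (m : ℕ) :
    weight p (1 - (m + 1 : ℕ)) a =
      (a : ℤ_[p]) ^ m * (((theta p (toUnit p a))⁻¹ : ℤ_[p]ˣ) : ℤ_[p]) ^ (m + 1) := by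
  rw [weight, sub_sub_cancel, anglePow_natCast, angle, Units.val_mul, mul_pow, ← mul_assoc,
    pow_succ', ← mul_assoc, Units.inv_mul, one_mul, coe_toUnit ha]

theorem anglePow_one_sub {a : ℤ} (ha : IsCoprime a (p : ℤ)) (m : ℕ) :
    anglePow p (toUnit p a) (1 - (1 - (m : ℤ_[p]))) =
      (a : ℤ_[p]) ^ m * (((theta p (toUnit p a))⁻¹ : ℤ_[p]ˣ) : ℤ_[p]) ^ m := by
  rw [sub_sub_cancel, anglePow_natCast, angle, Units.val_mul, mul_pow, coe_toUnit ha]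

/-- If `⟨u⟩^t = 1` with `t ≠ 0`, then `⟨u⟩` is a root of unity of `p`-power order: the exponents
killing `⟨u⟩` form a closed ideal of `ℤ_p`. -/
theorem exists_pow_angle_eq_one {u : ℤ_[p]ˣ} {t : ℤ_[p]} (ht : t ≠ 0) (h : anglePow p u t = 1) :
    ∃ v : ℕ, (angle p u : ℤ_[p]) ^ p ^ v = 1 := by
  have hideal (s : ℤ_[p]) : anglePow p u (t * s) = 1 := by
    refine congrFun (PadicInt.denseRange_natCast.equalizer
      ((continuous_anglePow u).comp (continuous_const.mul continuous_id))
      (continuous_const (y := (1 : ℤ_[p]))) (funext fun n => ?_)) s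
    change anglePow p u (t * n) = 1
    rw [anglePow_mul_natCast, h, one_pow]
  refine ⟨t.valuation, ?_⟩
  have h1 := hideal ((PadicInt.unitCoeff ht)⁻¹ : ℤ_[p]ˣ)
  have h2 : t * ((PadicInt.unitCoeff ht)⁻¹ : ℤ_[p]ˣ) = ((p ^ t.valuation : ℕ) : ℤ_[p]) := by
    conv_lhs => enter [1]; rw [PadicInt.unitCoeff_spec ht]
    rw [mul_right_comm, Units.mul_inv, one_mul, Nat.cast_pow]
  rwa [h2, anglePow_natCast] at h1

theorem norm_toCp (x : ℤ_[p]) : ‖toCp p x‖ = ‖x‖ := by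
  rw [toCp, RingHom.comp_apply]
  exact PadicComplex.norm_extends' p _

theorem continuous_toCp : Continuous (toCp p) :=
  (AddMonoidHomClass.isometry_of_norm (toCp p) norm_toCp).continuous

end

/-! ### The group ring measure and its Mellin transform -/

theorem artinSymbol_val {L : IntermediateField ℚ QBar} [IsAbelianField L] {f : ℕ}
    (hL : conductor L ∣ f) (hf : 0 < f) {a : ℤ} (ha : IsCoprime a (f : ℤ)) {x : ZMod f}
    (hx : (a : ZMod f) = x) : artinSymbol L (x.val : ℤ) = artinSymbol L a := by
  have : NeZero f := ⟨hf.ne'⟩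
  refine (artinSymbol_congr (ha.of_isCoprime_of_dvd_right (Int.natCast_dvd_natCast.2 hL)) ?_).symm
  refine (Int.natCast_dvd_natCast.2 hL).trans ?_
  rw [← ZMod.intCast_eq_intCast_iff_dvd_sub, hx, Int.cast_natCast, ZMod.natCast_zmod_val]

theorem single_intCast_mul {R : Type*} [CommRing R] {G : Type*} (σ : G) (k : ℤ) (r : R) :
    MonoidAlgebra.single σ ((k : R) * r) = k • MonoidAlgebra.single σ r := by
  rw [← zsmul_eq_mul, MonoidAlgebra.smul_single]

/-- The element `∑_a [λ_a(c) + (1 - c)/2] (L/a)⁻¹` of the integral group ring. -/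
noncomputable def integralStickelberger (L : IntermediateField ℚ QBar) [IsAbelianField L] (c : ℤ) :
    MonoidAlgebra ℤ Gal(L/ℚ) :=
  ∑ a ∈ primeTo (conductor L),
    MonoidAlgebra.single (artinSymbol L a)⁻¹ (twistCoeff (conductor L) c a)

theorem mapRingHom_integralStickelberger (L : IntermediateField ℚ QBar) [IsAbelianField L] {c : ℤ}
    (hodd : Odd c) (hc : IsCoprime c (conductor L : ℤ)) :
    MonoidAlgebra.mapRingHom _ (Int.castRingHom ℚ) (integralStickelberger L c) =
      twistedStickelberger L c := by
  have hf := (conductor_spec L).1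
  set f := conductor L with hfdef
  have key := sum_aPrime hf hc fun a x =>
    MonoidAlgebra.single (artinSymbol L (x.val : ℤ))⁻¹ (c * ((a : ℚ) / f - 1 / 2))
  have h1 : ∀ a ∈ primeTo f,
      artinSymbol L (((a : ZMod f)).val : ℤ) = artinSymbol L a := fun a ha =>
    artinSymbol_val dvd_rfl hf (isCoprime_of_mem_primeTo ha) (by rw [Int.cast_natCast])
  have h2 : ∀ a ∈ primeTo f, artinSymbol L (((c : ZMod f) * (a : ZMod f)).val : ℤ) =
      artinSymbol L c * artinSymbol L a := fun a ha => by
    rw [← artinSymbol_mul hc (isCoprime_of_mem_primeTo ha)]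
    exact artinSymbol_val dvd_rfl hf (hc.mul_left (isCoprime_of_mem_primeTo ha)) (by push_cast; rfl)
  rw [twistedStickelberger, stickelberger, integralStickelberger, map_sum, ← hfdef, sub_mul,
    one_mul, mul_neg, Finset.mul_sum, sub_neg_eq_add, neg_add_eq_sub]
  have h3 : ∑ a ∈ primeTo f, MonoidAlgebra.single (artinSymbol L c)⁻¹ (c : ℚ) *
        MonoidAlgebra.single (artinSymbol L a)⁻¹ ((a : ℚ) / f - 1 / 2) =
      ∑ a ∈ primeTo f, MonoidAlgebra.single (artinSymbol L a)⁻¹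
        (c * ((aPrime f c a : ℚ) / f - 1 / 2)) := by
    refine Eq.trans (Finset.sum_congr rfl fun a ha => ?_) (key.symm.trans
      (Finset.sum_congr rfl fun a ha => ?_))
    · have hcomm : artinSymbol L c * artinSymbol L a = artinSymbol L a * artinSymbol L c := by
        rw [← artinSymbol_mul hc (isCoprime_of_mem_primeTo ha), mul_comm,
          artinSymbol_mul (isCoprime_of_mem_primeTo ha) hc]
      rw [h2 a ha, MonoidAlgebra.single_mul_single, hcomm, mul_inv_rev]
    · rw [h1 a ha]
  rw [h3, ← Finset.sum_sub_distrib]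
  refine Finset.sum_congr rfl fun a _ => ?_
  rw [← MonoidAlgebra.single_sub, MonoidAlgebra.mapRingHom_single, eq_intCast,
    twistCoeff_eq hf hc hodd]

theorem normMap_single {L M : IntermediateField ℚ QBar} [IsAbelianField L] (h : L ≤ M)
    {R S : Type} [CommRing R] [CommRing S] (φ : R →+* S) (σ : Gal(M/ℚ)) (r : R) :
    normMap h φ (MonoidAlgebra.single σ r) = MonoidAlgebra.single (restrictGal h σ) (φ r) := by
  simp [normMap]

section

variable (p : ℕ)

theorem level_dvd_lcm (f n : ℕ) : level p n ∣ f.lcm (level p n) := Nat.dvd_lcm_right _ _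

theorem isCoprime_lcm_level {f : ℕ} {c : ℤ} (hcf : IsCoprime c (f : ℤ)) (hcp : IsCoprime c (p : ℤ))
    (n : ℕ) : IsCoprime c (f.lcm (level p n) : ℕ) := by
  refine IsCoprime.of_isCoprime_of_dvd_right (hcf.mul_right (hcp.pow_right (n := qExp p + n))) ?_
  exact_mod_cast Nat.lcm_dvd_mul f (level p n)

theorem dvd_lcm_level (f n : ℕ) : p ∣ f.lcm (level p n) :=
  (dvd_pow_self p (by have := qExp_ne_zero p; omega)).trans (level_dvd_lcm p f n)

theorem coprime_lcm_level_iff {f n a : ℕ} :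
    a.Coprime (f.lcm (level p n)) ↔ a.Coprime f ∧ a.Coprime p := by
  have hne : qExp p + n ≠ 0 := by have := qExp_ne_zero p; omega
  refine ⟨fun h => ⟨h.coprime_dvd_right (Nat.dvd_lcm_left _ _),
    h.coprime_dvd_right (dvd_lcm_level p f n)⟩, fun h => ?_⟩
  exact (h.1.mul_right (h.2.pow_right _)).coprime_dvd_right (Nat.lcm_dvd_mul _ _)

theorem isCoprime_of_mem_primeTo_lcm {p f n a : ℕ} (h : a ∈ primeTo (f.lcm (level p n))) :
    IsCoprime (a : ℤ) (p : ℤ) :=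
  (isCoprime_of_mem_primeTo h).of_isCoprime_of_dvd_right
    (Int.natCast_dvd_natCast.2 (dvd_lcm_level p f n))

variable [hp : Fact p.Prime] (K : IntermediateField ℚ QBar) [IsAbelianField K]

theorem lcm_level_pos {f : ℕ} (hf : 0 < f) (n : ℕ) : 0 < f.lcm (level p n) :=
  Nat.lcm_pos hf (level_pos p n)

theorem lcm_level_dvd (f n : ℕ) : f.lcm (level p n) ∣ f.lcm (level p (n + 1)) :=
  Nat.lcm_dvd (Nat.dvd_lcm_left _ _) ((level_dvd p n).trans (Nat.dvd_lcm_right _ _))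

theorem sum_twistCoeff_level {M : Type*} [AddCommGroup M] {f : ℕ} (hf : 0 < f) {c : ℤ}
    (hcf : IsCoprime c (f : ℤ)) (hcp : IsCoprime c (p : ℤ)) (hodd : Odd c) (n : ℕ)
    (h : ZMod (f.lcm (level p n)) → M) :
    ∑ a ∈ primeTo (f.lcm (level p (n + 1))), twistCoeff (f.lcm (level p (n + 1))) c a • h a =
      ∑ a ∈ primeTo (f.lcm (level p n)), twistCoeff (f.lcm (level p n)) c a • h a :=
  sum_twistCoeff_smul (lcm_level_pos p hf _) (lcm_level_dvd p f n)
    (fun _ ha => (coprime_lcm_level_iff p).2 ((coprime_lcm_level_iff p).1 ha))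
    (isCoprime_lcm_level p hcf hcp _) hodd h

variable {K}

theorem normMap_integralStickelberger {c : ℤ} (hodd : Odd c) (hcp : IsCoprime c (p : ℤ))
    (hcK : IsCoprime c (conductor K : ℤ)) (n : ℕ) :
    normMap (tower_le p K n) (RingHom.id ℤ) (integralStickelberger (tower p K (n + 1)) c) =
      integralStickelberger (tower p K n) c := by
  have hf := (conductor_spec K).1
  rw [integralStickelberger, integralStickelberger, map_sum]
  have key := sum_twistCoeff_level p hf hcK hcp hodd n fun x =>
    MonoidAlgebra.single (artinSymbol (tower p K n) (x.val : ℤ))⁻¹ (1 : ℤ)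
  rw [← conductor_tower, ← conductor_tower] at key
  have hdvd := conductor_dvd_of_le (tower_le p K n)
  refine Eq.trans (Finset.sum_congr rfl fun a ha => ?_) (key.trans
      (Finset.sum_congr rfl fun a ha => ?_))
  · have ha' := isCoprime_of_mem_primeTo ha
    rw [normMap_single, map_inv, restrictGal_artinSymbol _ ha', ← single_intCast_mul,
      artinSymbol_val dvd_rfl (conductor_spec _).1 (a := a)
        (ha'.of_isCoprime_of_dvd_right (Int.natCast_dvd_natCast.2 hdvd)) (by rw [Int.cast_natCast])]
    simp
  · rw [← single_intCast_mul, artinSymbol_val dvd_rfl (conductor_spec _).1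
      (isCoprime_of_mem_primeTo ha) (by rw [Int.cast_natCast])]
    simp

theorem mellin_add (s : ℤ_[p]) (n : ℕ)
    (x y : MonoidAlgebra (ZMod (level p n)) Gal(tower p K n/ℚ)) :
    mellin p K s n (x + y) = mellin p K s n x + mellin p K s n y := by
  classical
  rw [mellin, MonoidAlgebra.coeff_add]
  exact Finsupp.sum_add_index' (fun _ => by simp)
    fun _ _ _ => by rw [add_mul, MonoidAlgebra.single_add]

theorem mellin_single (s : ℤ_[p]) (n : ℕ) (σ : Gal(tower p K n/ℚ)) (r : ZMod (level p n)) :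
    mellin p K s n (MonoidAlgebra.single σ r) = MonoidAlgebra.single σ⁻¹
      (r * PadicInt.toZModPow (qExp p + n) (mellinChar p s (toUnit p (artinRep p K n σ)))) := by
  rw [mellin, MonoidAlgebra.coeff_single, Finsupp.sum_single_index (by simp)]
  rfl

theorem isCoprime_of_isCoprime_conductor_tower {n : ℕ} {a : ℤ}
    (h : IsCoprime a (conductor (tower p K n) : ℤ)) : IsCoprime a (p : ℤ) := by
  rw [conductor_tower] at h
  exact h.of_isCoprime_of_dvd_right (Int.natCast_dvd_natCast.2 (dvd_lcm_level p _ n))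

variable {p} in
/-- The chosen integer with Artin symbol `(L_n/a)⁻¹` is an inverse of `a` modulo `qp^n`, so that it
contributes the weight `a⁻¹⟨a⟩^{1-s}` to the Mellin transform. -/
theorem toZModPow_mellinChar_artinRep (s : ℤ_[p]) {n : ℕ} {a : ℤ}
    (ha : IsCoprime a (conductor (tower p K n) : ℤ)) :
    PadicInt.toZModPow (qExp p + n)
        (mellinChar p s (toUnit p (artinRep p K n (artinSymbol (tower p K n) a)⁻¹))) =
      PadicInt.toZModPow (qExp p + n) (weight p s a) := by
  have hlev : level p n ∣ conductor (tower p K n) := by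
    rw [conductor_tower]
    exact level_dvd_lcm p _ n
  have hex : ∃ b : ℤ, IsCoprime b (conductor (tower p K n) : ℤ) ∧
      artinSymbol (tower p K n) b = (artinSymbol (tower p K n) a)⁻¹ := by
    obtain ⟨b, v, hbv⟩ := ha
    have hb : IsCoprime b (conductor (tower p K n) : ℤ) := ⟨a, v, by rw [mul_comm a b]; exact hbv⟩
    refine ⟨b, hb, eq_inv_of_mul_eq_one_left ?_⟩
    rw [← artinSymbol_mul hb ⟨b, v, hbv⟩, ← artinSymbol_one]
    exact artinSymbol_congr (hb.mul_left ⟨b, v, hbv⟩) ⟨-v, by linear_combination hbv⟩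
  obtain ⟨hb, hba⟩ := Classical.epsilon_spec hex
  change IsCoprime (artinRep p K n (artinSymbol (tower p K n) a)⁻¹) _ at hb
  change artinSymbol (tower p K n) (artinRep p K n (artinSymbol (tower p K n) a)⁻¹) = _ at hba
  set b := artinRep p K n (artinSymbol (tower p K n) a)⁻¹
  have h1 : (level p n : ℤ) ∣ b * a - 1 := by
    refine dvd_sub_of_artinSymbol_eq (level_pos p n) le_sup_right hlev (hb.mul_left ha)
      isCoprime_one_left ?_
    rw [artinSymbol_mul hb ha, hba, inv_mul_cancel, artinSymbol_one]
  rw [weight_eq]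
  refine toZModPow_mellinChar s (toZModPow_inv ?_)
  rw [Units.val_mul, coe_toUnit (isCoprime_of_isCoprime_conductor_tower p hb),
    coe_toUnit (isCoprime_of_isCoprime_conductor_tower p ha), ← Int.cast_mul,
    toZModPow_intCast_eq h1, Int.cast_one, map_one]

theorem mellinInt_integralStickelberger (c : ℤ) (s : ℤ_[p]) (n : ℕ) :
    mellinInt p K s n (integralStickelberger (tower p K n) c) =
      ∑ a ∈ primeTo (conductor (tower p K n)), MonoidAlgebra.single (artinSymbol (tower p K n) a)
        (PadicInt.toZModPow (qExp p + n)
          ((twistCoeff (conductor (tower p K n)) c a : ℤ_[p]) * weight p s a)) := by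
  have hzero : mellin p K s n 0 = 0 := by
    have := mellin_add p s n (0 : MonoidAlgebra (ZMod (level p n)) Gal(tower p K n/ℚ)) 0
    rw [add_zero] at this
    exact left_eq_add.1 this
  let φ : MonoidAlgebra (ZMod (level p n)) Gal(tower p K n/ℚ) →+
      MonoidAlgebra (ZMod (level p n)) Gal(tower p K n/ℚ) :=
    ⟨⟨mellin p K s n, hzero⟩, mellin_add p s n⟩
  rw [mellinInt, integralStickelberger, map_sum]
  refine (map_sum φ _ _).trans (Finset.sum_congr rfl fun a ha => ?_)
  change mellin p K s n _ = _
  rw [MonoidAlgebra.mapRingHom_single, mellin_single, inv_inv,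
    toZModPow_mellinChar_artinRep s (isCoprime_of_mem_primeTo ha), map_mul, map_intCast, eq_intCast]

theorem normMap_mellinInt_integralStickelberger {c : ℤ} (hodd : Odd c)
    (hcp : IsCoprime c (p : ℤ)) (hcK : IsCoprime c (conductor K : ℤ)) (s : ℤ_[p]) (n : ℕ) :
    normMap (tower_le p K n) (ZMod.castHom (level_dvd p n) (ZMod (level p n)))
        (mellinInt p K s (n + 1) (integralStickelberger (tower p K (n + 1)) c)) =
      mellinInt p K s n (integralStickelberger (tower p K n) c) := by
  have hf := (conductor_spec K).1
  rw [mellinInt_integralStickelberger, mellinInt_integralStickelberger, map_sum]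
  have key := sum_twistCoeff_level p hf hcK hcp hodd n fun x =>
    MonoidAlgebra.single (artinSymbol (tower p K n) (x.val : ℤ))
      (PadicInt.toZModPow (qExp p + n) (weight p s (x.val : ℤ)))
  rw [← conductor_tower, ← conductor_tower] at key
  have hdvd := conductor_dvd_of_le (tower_le p K n)
  have hlev : level p n ∣ conductor (tower p K n) := by
    rw [conductor_tower]
    exact level_dvd_lcm p _ n
  have hpos := (conductor_spec (tower p K n)).1
  have : NeZero (conductor (tower p K n)) := ⟨hpos.ne'⟩
  have hval {a : ℤ} (ha : IsCoprime a (conductor (tower p K n) : ℤ)) :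
      PadicInt.toZModPow (qExp p + n) (weight p s ((a : ZMod (conductor (tower p K n))).val : ℤ)) =
        PadicInt.toZModPow (qExp p + n) (weight p s a) := by
    have h1 : (conductor (tower p K n) : ℤ) ∣
        ((a : ZMod (conductor (tower p K n))).val : ℤ) - a := by
      rw [← ZMod.intCast_eq_intCast_iff_dvd_sub, Int.cast_natCast, ZMod.natCast_zmod_val]
    refine toZModPow_weight s ?_ (isCoprime_of_isCoprime_conductor_tower p ha)
      ((Int.natCast_dvd_natCast.2 hlev).trans h1)
    refine isCoprime_of_isCoprime_conductor_tower (K := K) (n := n) p ?_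
    obtain ⟨k, hk⟩ := h1
    rw [show ((a : ZMod (conductor (tower p K n))).val : ℤ) =
      a + conductor (tower p K n) * k by linarith]
    exact ha.add_mul_left_left k
  refine Eq.trans (Finset.sum_congr rfl fun a ha => ?_) (key.trans
      (Finset.sum_congr rfl fun a ha => ?_))
  · have ha' := isCoprime_of_mem_primeTo ha
    have ha'' := ha'.of_isCoprime_of_dvd_right (Int.natCast_dvd_natCast.2 hdvd)
    have hw := hval ha''
    rw [Int.cast_natCast] at hw
    rw [normMap_single, restrictGal_artinSymbol _ ha', ← single_intCast_mul,
      artinSymbol_val dvd_rfl hpos ha'' (by rw [Int.cast_natCast]), hw]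
    congr 1
    rw [← map_intCast (PadicInt.toZModPow (p := p) (qExp p + n)), ← map_mul,
      ← PadicInt.zmod_cast_comp_toZModPow (p := p) (qExp p + n) (qExp p + (n + 1)) (by omega)]
    rfl
  · have ha' := isCoprime_of_mem_primeTo ha
    have hw := hval ha'
    rw [Int.cast_natCast] at hw
    rw [← single_intCast_mul, artinSymbol_val dvd_rfl hpos ha' (by rw [Int.cast_natCast]), hw,
      map_mul, map_intCast]

theorem normMap_le_sup_left_mellinInt (c : ℤ) (s : ℤ_[p]) (n : ℕ) :
    normMap (le_sup_left : K ≤ tower p K n) (RingHom.id _)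
        (mellinInt p K s n (integralStickelberger (tower p K n) c)) =
      ∑ a ∈ primeTo (conductor (tower p K n)), MonoidAlgebra.single (artinSymbol K a)
        (PadicInt.toZModPow (qExp p + n)
          ((twistCoeff (conductor (tower p K n)) c a : ℤ_[p]) * weight p s a)) := by
  rw [mellinInt_integralStickelberger, map_sum]
  refine Finset.sum_congr rfl fun a ha => ?_
  rw [normMap_single, restrictGal_artinSymbol _ (isCoprime_of_mem_primeTo ha), RingHom.id_apply]

end

/-! ### The Hurwitz zeta function at `0` -/

/-- The error of the trapezoidal rule for `(s - 1) ∫ y^{-s} dy` on `[y, y + t]`. -/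
noncomputable def trapezoidError (s : ℂ) (y : ℝ) (t : ℂ) : ℂ :=
  (s - 1) / 2 * (t * ((y : ℂ) ^ (-s) + (y + t) ^ (-s))) + ((y + t) ^ (1 - s) - (y : ℂ) ^ (1 - s))

theorem hasDerivAt_add_cpow {y t : ℝ} (h : 0 < y + t) (w : ℂ) :
    HasDerivAt (fun z : ℂ => ((y : ℂ) + z) ^ w) (w * ((y : ℂ) + t) ^ (w - 1)) (t : ℂ) := by
  have h1 : HasDerivAt (fun z : ℂ => (y : ℂ) + z) 1 (t : ℂ) := (hasDerivAt_id _).const_add _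
  have h2 : (y : ℂ) + t ∈ Complex.slitPlane := by
    rw [← Complex.ofReal_add, Complex.ofReal_mem_slitPlane]
    exact h
  simpa using h1.cpow_const (c := w) h2

/-- As a function of `t` the error vanishes to second order at `0`, and its second derivative is
`s(s - 1)(s + 1)/2 · t (y + t)^{-s-2}`; the two powers of `y` cover the cases `y ≤ 1` and `y ≥ 1`. -/
theorem norm_trapezoidError_le {s : ℂ} {y : ℝ} (hy : 0 < y) (hs : -(1 / 2) < s.re) (hs3 : ‖s‖ < 3) :
    ‖trapezoidError s y 1‖ ≤ 24 * (1 / y ^ (3 / 2 : ℝ) + 1 / y ^ (5 : ℝ)) := by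
  set B : ℝ := 24 * (1 / y ^ (3 / 2 : ℝ) + 1 / y ^ (5 : ℝ)) with hB
  have hB0 : 0 ≤ B := by positivity
  let g : ℂ → ℂ := fun t => (s - 1) / 2 * ((y : ℂ) ^ (-s) - (y + t) ^ (-s)) -
    s * (s - 1) / 2 * (t * (y + t) ^ (-s - 1))
  have hd1 {t : ℝ} (ht : 0 ≤ t) : HasDerivAt (trapezoidError s y) (g t) t := by
    have h := hasDerivAt_add_cpow (add_pos_of_pos_of_nonneg hy ht) (-s)
    have h' := hasDerivAt_add_cpow (add_pos_of_pos_of_nonneg hy ht) (1 - s)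
    have := (((hasDerivAt_id (t : ℂ)).mul (h.const_add ((y : ℂ) ^ (-s)))).const_mul
      ((s - 1) / 2)).add (h'.sub_const ((y : ℂ) ^ (1 - s)))
    convert! this using 1
    rw [show 1 - s - 1 = -s by ring]
    simp only [g, id]
    ring
  have hd2 {t : ℝ} (ht : 0 ≤ t) : HasDerivAt g
      (s * (s - 1) * (s + 1) / 2 * (t * (y + t) ^ (-s - 2))) t := by
    have h := hasDerivAt_add_cpow (add_pos_of_pos_of_nonneg hy ht) (-s)
    have h' := hasDerivAt_add_cpow (add_pos_of_pos_of_nonneg hy ht) (-s - 1)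
    have := ((h.const_sub ((y : ℂ) ^ (-s))).const_mul ((s - 1) / 2)).sub
      (((hasDerivAt_id (t : ℂ)).mul h').const_mul (s * (s - 1) / 2))
    convert! this using 1
    rw [show -s - 1 - 1 = -s - 2 by ring]
    simp only [id]
    ring
  have hbound {t : ℝ} (ht : 0 ≤ t) (ht1 : t ≤ 1) :
      ‖s * (s - 1) * (s + 1) / 2 * (t * (y + t) ^ (-s - 2))‖ ≤ B := by
    have hyt : 0 < y + t := add_pos_of_pos_of_nonneg hy ht
    have hre : (-s - 2).re = -s.re - 2 := by simp
    have h1 : ‖((y : ℂ) + t) ^ (-s - 2)‖ ≤ 1 / y ^ (3 / 2 : ℝ) + 1 / y ^ (5 : ℝ) := by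
      rw [← Complex.ofReal_add, Complex.norm_cpow_eq_rpow_re_of_pos hyt, hre]
      have hσ := (Complex.abs_re_le_norm s).trans hs3.le
      rw [abs_le] at hσ
      refine (Real.rpow_le_rpow_of_nonpos hy (by linarith) (by linarith)).trans ?_
      rcases le_total y 1 with h | h
      · refine (Real.rpow_le_rpow_of_exponent_ge hy h (by linarith : (-5 : ℝ) ≤ _)).trans ?_
        rw [Real.rpow_neg hy.le, ← one_div]
        exact le_add_of_nonneg_left (by positivity)
      · refine (Real.rpow_le_rpow_of_exponent_le h (by linarith : _ ≤ (-(3 / 2) : ℝ))).trans ?_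
        rw [Real.rpow_neg hy.le, ← one_div]
        exact le_add_of_nonneg_right (by positivity)
    have h2 : ‖s - 1‖ ≤ 4 := (norm_sub_le _ _).trans (by rw [norm_one]; linarith)
    have h3 : ‖s + 1‖ ≤ 4 := (norm_add_le _ _).trans (by rw [norm_one]; linarith)
    rw [norm_mul, norm_div, norm_mul, norm_mul, norm_mul, Complex.norm_real, Real.norm_eq_abs,
      abs_of_nonneg ht, hB, Complex.norm_ofNat]
    have h4 : ‖s‖ * ‖s - 1‖ * ‖s + 1‖ / 2 ≤ 24 := by
      have : ‖s‖ * ‖s - 1‖ * ‖s + 1‖ ≤ 3 * 4 * 4 := by gcongr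
      linarith
    have h5 : t * ‖((y : ℂ) + t) ^ (-s - 2)‖ ≤ 1 * (1 / y ^ (3 / 2 : ℝ) + 1 / y ^ (5 : ℝ)) := by
      gcongr
    rw [one_mul] at h5
    gcongr
  have hg {t : ℝ} (ht : 0 ≤ t) (ht1 : t ≤ 1) : ‖g t‖ ≤ B := by
    have := norm_image_sub_le_of_norm_deriv_le_segment' (f := fun r : ℝ => g r) (a := 0) (b := 1)
      (fun r hr => ((hd2 hr.1).comp_ofReal).hasDerivWithinAt)
      (fun r hr => hbound hr.1 hr.2.le) t ⟨ht, ht1⟩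
    have h0 : g (0 : ℝ) = 0 := by simp [g]
    rw [h0, sub_zero, sub_zero] at this
    exact this.trans (mul_le_of_le_one_right hB0 ht1)
  have := norm_image_sub_le_of_norm_deriv_le_segment_01' (f := fun r : ℝ => trapezoidError s y r)
    (fun r hr => ((hd1 hr.1).comp_ofReal).hasDerivWithinAt) (fun r hr => hg hr.1 hr.2.le)
  simpa [trapezoidError] using this

theorem trapezoidError_eq (s : ℂ) (y : ℝ) : trapezoidError s y 1 =
    (s - 1) * (1 / (y : ℂ) ^ s) +
      ((((y + 1 : ℝ) : ℂ) ^ (1 - s) + (s - 1) / 2 * ((y + 1 : ℝ) : ℂ) ^ (-s)) -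
        ((y : ℂ) ^ (1 - s) + (s - 1) / 2 * (y : ℂ) ^ (-s))) := by
  rw [trapezoidError, Complex.ofReal_add, Complex.ofReal_one, Complex.cpow_neg (y : ℂ), one_div]
  ring

theorem tendsto_natCast_add_cpow (x : ℝ) {w : ℂ} (hw : w.re < 0) :
    Filter.Tendsto (fun n : ℕ => ((n + x : ℝ) : ℂ) ^ w) Filter.atTop (𝓝 0) := by
  rw [tendsto_zero_iff_norm_tendsto_zero]
  have h1 : Filter.Tendsto (fun n : ℕ => (n + x : ℝ)) Filter.atTop Filter.atTop :=
    Filter.tendsto_atTop_add_const_right _ _ tendsto_natCast_atTop_atTop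
  have h2 := (tendsto_rpow_neg_atTop (neg_pos.2 hw)).comp h1
  rw [neg_neg] at h2
  refine h2.congr' ?_
  filter_upwards [h1.eventually_gt_atTop 0] with n hn
  rw [Complex.norm_cpow_eq_rpow_re_of_pos hn]
  rfl

/-- The boundary term of the trapezoidal rule. -/
noncomputable def trapezoidBoundary (s : ℂ) (y : ℝ) : ℂ :=
  (y : ℂ) ^ (1 - s) + (s - 1) / 2 * (y : ℂ) ^ (-s)

theorem differentiable_cpow_comp {y : ℝ} (hy : 0 < y) {w : ℂ → ℂ} (hw : Differentiable ℂ w) :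
    Differentiable ℂ fun s => (y : ℂ) ^ w s :=
  hw.const_cpow (Or.inl (by exact_mod_cast hy.ne'))

/-- The odd part of the Hurwitz zeta function at `0`, which comes from summing `n + x` and
`n + 1 - x` by the trapezoidal rule: its error terms vanish at `s = 0`. -/
theorem hurwitzZetaOdd_zero {x : ℝ} (hx0 : 0 < x) (hx1 : x < 1) :
    HurwitzZeta.hurwitzZetaOdd x 0 = 1 / 2 - x := by
  let F : ℕ → ℂ → ℂ := fun n s => trapezoidError s (n + x) 1 - trapezoidError s (n + (1 - x)) 1
  -- a convex region on which the error terms are summable, containing `0` and the point `2` of the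
  -- half-plane of convergence
  let U : Set ℂ := {s | -(1 / 2) < s.re} ∩ Metric.ball 0 3
  have hU : IsOpen U := (isOpen_lt continuous_const Complex.continuous_re).inter Metric.isOpen_ball
  have hUc : IsPreconnected U :=
    ((convex_halfSpace_re_gt _).inter (convex_ball _ _)).isPreconnected
  have hpos {y : ℝ} (hy : 0 < y) (n : ℕ) : 0 < n + y := by positivity
  let u : ℝ → ℕ → ℝ := fun y n => 24 * (1 / (n + y) ^ (3 / 2 : ℝ) + 1 / (n + y) ^ (5 : ℝ))
  have hu {y : ℝ} (hy : 0 < y) : Summable (u y) := by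
    have h (r : ℝ) (hr : 1 < r) : Summable fun n : ℕ => 1 / ((n : ℝ) + y) ^ r := by
      have := (Real.summable_one_div_nat_add_rpow y r).2 hr
      refine this.congr fun n => ?_
      rw [abs_of_pos (hpos hy n)]
    exact ((h _ (by norm_num)).add (h _ (by norm_num))).mul_left 24
  have hx1' : 0 < 1 - x := by linarith
  have hFle (n : ℕ) (s : ℂ) (hs : s ∈ U) : ‖F n s‖ ≤ u x n + u (1 - x) n := by
    have hs' : ‖s‖ < 3 := by simpa using hs.2
    exact (norm_sub_le _ _).trans (add_le_add (norm_trapezoidError_le (hpos hx0 n) hs.1 hs')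
      (norm_trapezoidError_le (hpos hx1' n) hs.1 hs'))
  have hFsum {s : ℂ} (hs : s ∈ U) : Summable fun n => F n s :=
    Summable.of_norm_bounded ((hu hx0).add (hu hx1')) fun n => hFle n s hs
  have hFd (n : ℕ) : Differentiable ℂ (F n) := by
    have h {y : ℝ} (hy : 0 < y) : Differentiable ℂ fun s => trapezoidError s y 1 := by
      simp only [trapezoidError_eq, one_div, ← Complex.cpow_neg]
      have hy1 : 0 < y + 1 := by linarith
      have d1 := differentiable_cpow_comp hy differentiable_neg
      have d2 := differentiable_cpow_comp hy1 differentiable_neg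
      have d3 := differentiable_cpow_comp hy (differentiable_id.const_sub 1)
      have d4 := differentiable_cpow_comp hy1 (differentiable_id.const_sub 1)
      have d5 : Differentiable ℂ fun s : ℂ => s - 1 := differentiable_id.sub_const 1
      exact (d5.mul d1).add
        ((d4.add ((d5.div_const 2).mul d2)).sub (d3.add ((d5.div_const 2).mul d1)))
    exact (h (hpos hx0 n)).sub (h (hpos hx1' n))
  have hbd {y : ℝ} (hy : 0 < y) : Differentiable ℂ fun s => trapezoidBoundary s y := by
    have d1 := differentiable_cpow_comp hy differentiable_neg
    have d3 := differentiable_cpow_comp hy (differentiable_id.const_sub 1)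
    have d5 : Differentiable ℂ fun s : ℂ => s - 1 := differentiable_id.sub_const 1
    exact d3.add ((d5.div_const 2).mul d1)
  let A : ℂ → ℂ := fun s => (s - 1) * (2 * HurwitzZeta.hurwitzZetaOdd x s)
  let B : ℂ → ℂ := fun s =>
    (∑' n, F n s) + (trapezoidBoundary s x - trapezoidBoundary s (1 - x))
  have hA : DifferentiableOn ℂ A U :=
    ((differentiable_id.sub_const 1).mul
      ((HurwitzZeta.differentiable_hurwitzZetaOdd _).const_mul 2)).differentiableOn
  have hB : DifferentiableOn ℂ B U :=
    (Complex.differentiableOn_tsum_of_summable_norm ((hu hx0).add (hu hx1'))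
      (fun n => (hFd n).differentiableOn) hU hFle).add ((hbd hx0).sub (hbd hx1')).differentiableOn
  have hAB {s : ℂ} (hsU : s ∈ U) (hs : 1 < s.re) : A s = B s := by
    have hlim {y : ℝ} : Filter.Tendsto (fun n : ℕ => trapezoidBoundary s (n + y)) Filter.atTop
        (𝓝 0) := by
      have h1 := tendsto_natCast_add_cpow y (w := 1 - s) (by simpa using hs)
      have h2 := tendsto_natCast_add_cpow y (w := -s) (by simp; linarith)
      simpa [trapezoidBoundary] using h1.add (h2.const_mul ((s - 1) / 2))
    have h1 := (HurwitzZeta.hasSum_nat_hurwitzZetaOdd_of_mem_Icc ⟨hx0.le, hx1.le⟩ hs).mul_left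
      ((s - 1) * 2)
    have h2 := (hFsum hsU).hasSum.sub h1
    have h3 := h2.tendsto_sum_nat
    have h4 (n : ℕ) : F n s - (s - 1) * 2 * ((1 / ((n : ℂ) + x) ^ s -
        1 / ((n : ℂ) + 1 - x) ^ s) / 2) =
        (trapezoidBoundary s ((n + 1 : ℕ) + x) - trapezoidBoundary s ((n + 1 : ℕ) + (1 - x))) -
          (trapezoidBoundary s (n + x) - trapezoidBoundary s (n + (1 - x))) := by
      simp only [F, trapezoidError_eq, trapezoidBoundary]
      rw [show (n : ℝ) + x + 1 = ((n + 1 : ℕ) : ℝ) + x by push_cast; ring,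
        show (n : ℝ) + (1 - x) + 1 = ((n + 1 : ℕ) : ℝ) + (1 - x) by push_cast; ring,
        show (n : ℂ) + x = ((n + x : ℝ) : ℂ) by push_cast; ring,
        show (n : ℂ) + 1 - x = ((n + (1 - x) : ℝ) : ℂ) by push_cast; ring]
      ring
    simp only [h4] at h3
    simp only [Finset.sum_range_sub (fun n : ℕ =>
      trapezoidBoundary s (n + x) - trapezoidBoundary s (n + (1 - x)))] at h3
    have h5 := tendsto_nhds_unique h3 ((hlim.sub hlim).sub_const _)
    simp only [Nat.cast_zero, zero_add] at h5
    simp only [A, B]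
    linear_combination -h5
  have h2 : (2 : ℂ) ∈ U := ⟨by simp; norm_num, by simp; norm_num⟩
  have h0 : (0 : ℂ) ∈ U := ⟨by simp, by simp⟩
  have hev : A =ᶠ[𝓝 2] B := by
    filter_upwards [hU.mem_nhds h2, (isOpen_lt continuous_const Complex.continuous_re).mem_nhds
      (show (1 : ℝ) < (2 : ℂ).re by simp)] with s h1 h2 using hAB h1 h2
  have key : A 0 = B 0 := AnalyticOnNhd.eqOn_of_preconnected_of_eventuallyEq
    (hA.analyticOnNhd hU) (hB.analyticOnNhd hU) hUc h2 hev h0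
  have hF0 (n : ℕ) : F n 0 = 0 := by
    simp [F, trapezoidError]
  simp only [A, B, hF0, tsum_zero, trapezoidBoundary] at key
  simp at key
  linear_combination (-1 / 2 : ℂ) * key

theorem hurwitzZeta_zero_of_mem_Ioo {x : ℝ} (hx0 : 0 < x) (hx1 : x < 1) :
    HurwitzZeta.hurwitzZeta x 0 = 1 / 2 - x := by
  have hx : (x : UnitAddCircle) ≠ 0 := by
    intro h
    rw [AddCircle.coe_eq_zero_iff_of_mem_Ico (by simpa using ⟨hx0.le, hx1⟩)] at h
    exact hx0.ne' h
  rw [HurwitzZeta.hurwitzZeta, HurwitzZeta.hurwitzZetaEven_apply_zero, if_neg hx, zero_add,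
    hurwitzZetaOdd_zero hx0 hx1]

/-- For `k = 0` the end points of `[0, 1]` have to be excluded, where `B₁` jumps. -/
theorem hurwitzZeta_neg_natCast {x : ℝ} (hx0 : 0 < x) (hx1 : x < 1) (k : ℕ) :
    HurwitzZeta.hurwitzZeta x (-k) =
      -1 / (k + 1) * ((Polynomial.bernoulli (k + 1)).map (algebraMap ℚ ℂ)).eval (x : ℂ) := by
  rcases eq_or_ne k 0 with rfl | hk
  · rw [Nat.cast_zero, neg_zero, hurwitzZeta_zero_of_mem_Ioo hx0 hx1, zero_add,
      Polynomial.bernoulli_one]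
    simp
  · exact HurwitzZeta.hurwitzZeta_neg_nat hk ⟨hx0.le, hx1.le⟩

/-! ### Values of `L`-functions at non-positive integers -/

theorem sum_primeTo_eq_sum_zmod {R : Type*} [CommRing R] {F : ℕ} [NeZero F] (hF : 1 < F)
    (χ : DirichletCharacter R F) (h : ℕ → R) :
    ∑ j : ZMod F, χ j * h j.val = ∑ a ∈ primeTo F, χ a * h a := by
  classical
  rw [← Finset.sum_filter_of_ne (p := fun j : ZMod F => IsUnit j)]
  · symm
    refine Finset.sum_nbij' (fun a : ℕ => (a : ZMod F)) ZMod.val ?_ ?_ ?_ ?_ ?_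
    · intro a ha
      simpa [ZMod.isUnit_iff_coprime] using (mem_primeTo.1 ha).2
    · intro j hj
      obtain ⟨u, rfl⟩ := (Finset.mem_filter.1 hj).2
      have h1 := ZMod.val_coe_unit_coprime u
      refine mem_primeTo.2 ⟨⟨Nat.pos_of_ne_zero fun h0 => ?_, (ZMod.val_lt _).le⟩, h1⟩
      rw [h0, Nat.coprime_zero_left] at h1
      exact hF.ne' h1
    · intro a ha
      obtain ⟨⟨h1, h2⟩, h3⟩ := mem_primeTo.1 ha
      refine ZMod.val_cast_of_lt (lt_of_le_of_ne h2 ?_)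
      rintro rfl
      rw [Nat.coprime_self] at h3
      exact hF.ne' h3
    · intro j _
      exact ZMod.natCast_zmod_val j
    · intro a ha
      obtain ⟨⟨h1, h2⟩, h3⟩ := mem_primeTo.1 ha
      have : a < F := lt_of_le_of_ne h2 fun h => by
        subst h
        rw [Nat.coprime_self] at h3
        exact hF.ne' h3
      rw [ZMod.val_cast_of_lt this]
  · intro j _ hj
    by_contra hu
    exact hj (by rw [χ.map_nonunit hu, zero_mul])

/-- The value `-F^k/(k+1) ∑_a ψ(a) B_{k+1}(a/F)`, a sum over the integers of `[1, F]` prime to `F`: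
this is `L(-k, ψ)` deprived of its Euler factors at the primes dividing `F`. -/
noncomputable def bernoulliValue {R : Type*} [Field R] [CharZero R] {M : ℕ}
    (ψ : DirichletCharacter R M) (k F : ℕ) : R :=
  -((F : R) ^ k / (k + 1)) * ∑ a ∈ primeTo F, ψ (a : ZMod M) *
    ((Polynomial.bernoulli (k + 1)).map (algebraMap ℚ R)).eval ((a : R) / F)

theorem map_bernoulliValue {R S : Type*} [Field R] [CharZero R] [Field S] [CharZero S] {M : ℕ}
    (φ : R →+* S) (ψ : DirichletCharacter R M) (k F : ℕ) :
    φ (bernoulliValue ψ k F) = bernoulliValue (ψ.ringHomComp φ) k F := by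
  simp only [bernoulliValue, map_mul, map_neg, map_div₀, map_pow, map_natCast, map_add, map_one,
    map_sum, MulChar.ringHomComp_apply, Polynomial.eval_map, Polynomial.hom_eval₂]
  rw [show φ.comp (algebraMap ℚ R) = algebraMap ℚ S from Subsingleton.elim _ _]

theorem LFunction_neg_natCast {F : ℕ} [NeZero F] (hF : 1 < F) (χ : DirichletCharacter ℂ F) (k : ℕ) :
    DirichletCharacter.LFunction χ (-k) = bernoulliValue χ k F := by
  have hsum := sum_primeTo_eq_sum_zmod hF χ fun a => -1 / ((k : ℂ) + 1) *
    ((Polynomial.bernoulli (k + 1)).map (algebraMap ℚ ℂ)).eval ((a : ℂ) / F)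
  have hF0 : (0 : ℝ) < F := by exact_mod_cast (zero_lt_one.trans hF)
  rw [DirichletCharacter.LFunction, ZMod.LFunction, neg_neg, Complex.cpow_natCast]
  have h1 : ∑ j : ZMod F, χ j * HurwitzZeta.hurwitzZeta (ZMod.toAddCircle j) (-k) =
      ∑ j : ZMod F, χ j * (-1 / ((k : ℂ) + 1) *
        ((Polynomial.bernoulli (k + 1)).map (algebraMap ℚ ℂ)).eval ((j.val : ℂ) / F)) := by
    refine Finset.sum_congr rfl fun j _ => ?_
    rcases eq_or_ne j 0 with rfl | hj
    · have : Fact (1 < F) := ⟨hF⟩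
      rw [MulChar.map_zero, zero_mul, zero_mul]
    · have hval : (0 : ℝ) < j.val := by
        exact_mod_cast Nat.pos_of_ne_zero fun h => hj ((ZMod.val_eq_zero j).1 h)
      have hval' : (j.val : ℝ) < F := by exact_mod_cast ZMod.val_lt j
      rw [ZMod.toAddCircle_apply, hurwitzZeta_neg_natCast (div_pos hval hF0)
        ((div_lt_one hF0).2 hval')]
      push_cast
      rfl
  rw [h1, hsum, bernoulliValue, Finset.mul_sum, Finset.mul_sum]
  refine Finset.sum_congr rfl fun a _ => ?_
  ring

theorem bernoulliValue_eq_LFunction_mul {M F : ℕ} [NeZero M] [NeZero F] (hF : 1 < F) (hMF : M ∣ F)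
    (ψ : DirichletCharacter ℂ M) (k : ℕ) :
    bernoulliValue ψ k F = DirichletCharacter.LFunction ψ (-k) *
      ∏ l ∈ F.primeFactors, (1 - ψ (l : ZMod M) * (l : ℂ) ^ k) := by
  have hs : (-k : ℂ) ≠ 1 := by
    intro h
    have := congrArg Complex.re h
    simp at this
    linarith [(Nat.cast_nonneg k : (0 : ℝ) ≤ k)]
  have h1 := DirichletCharacter.LFunction_changeLevel hMF ψ (Or.inr hs)
  simp only [neg_neg, Complex.cpow_natCast] at h1
  rw [← h1, LFunction_neg_natCast hF, bernoulliValue, bernoulliValue]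
  congr 1
  refine Finset.sum_congr rfl fun a ha => ?_
  have := DirichletCharacter.changeLevel_eq_cast_of_dvd' ψ hMF (isCoprime_of_mem_primeTo ha)
  rw [Int.cast_natCast, Int.cast_natCast] at this
  rw [this]

/-! ### The congruence between twisted sums and Bernoulli values -/

theorem bernoulli_eval_div {R : Type*} [Field R] [CharZero R] (k F : ℕ) (hF : F ≠ 0) (a : R) :
    (F : R) ^ k * ((Polynomial.bernoulli (k + 1)).map (algebraMap ℚ R)).eval (a / F) =
      a ^ (k + 1) / F - (k + 1) / 2 * a ^ k + F * ∑ i ∈ Finset.range k,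
        (algebraMap ℚ R (bernoulli (i + 2) * (k + 1).choose (i + 2)) *
          a ^ (k - 1 - i) * F ^ i) := by
  have hF' : (F : R) ≠ 0 := Nat.cast_ne_zero.2 hF
  have h1 : ((Polynomial.bernoulli (k + 1)).map (algebraMap ℚ R)).eval (a / F) =
      ∑ i ∈ Finset.range (k + 2),
        algebraMap ℚ R (bernoulli i * (k + 1).choose i) * (a / F) ^ (k + 1 - i) := by
    rw [Polynomial.bernoulli, Polynomial.map_sum, Polynomial.eval_finsetSum]
    exact Finset.sum_congr rfl fun i _ => by
      rw [Polynomial.map_monomial, Polynomial.eval_monomial]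
  rw [h1, Finset.sum_range_succ', Finset.sum_range_succ', mul_add, mul_add, Finset.mul_sum,
    Finset.mul_sum]
  have h2 : ∀ i ∈ Finset.range k, (F : R) ^ k * (algebraMap ℚ R (bernoulli (i + 1 + 1) *
      (k + 1).choose (i + 1 + 1)) * (a / F) ^ (k + 1 - (i + 1 + 1))) =
      F * (algebraMap ℚ R (bernoulli (i + 2) * (k + 1).choose (i + 2)) * a ^ (k - 1 - i) *
        F ^ i) := by
    intro i hi
    have hik := Finset.mem_range.1 hi
    have h3 : k + 1 - (i + 1 + 1) = k - 1 - i := by omega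
    have h4 : (F : R) ^ k = F * F ^ i * F ^ (k - 1 - i) := by
      rw [← pow_succ', ← pow_add]
      congr 1
      omega
    rw [h3, h4, div_pow]
    field_simp
  rw [Finset.sum_congr rfl h2]
  have h5 : (F : R) ^ k * (algebraMap ℚ R (bernoulli (0 + 1) * (k + 1).choose (0 + 1)) *
      (a / F) ^ (k + 1 - (0 + 1))) = -((k + 1) / 2 * a ^ k) := by
    simp [bernoulli_one, div_pow]
    field_simp
  have h6 : (F : R) ^ k * (algebraMap ℚ R (bernoulli 0 * (k + 1).choose 0) *
      (a / F) ^ (k + 1 - 0)) = a ^ (k + 1) / F := by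
    simp [div_pow]
    field_simp
    ring
  rw [h5, h6]
  ring

section

variable {p : ℕ} [hp : Fact p.Prime]

theorem norm_intCast_le_one (z : ℤ) : ‖(z : ℂ_[p])‖ ≤ 1 := by
  have : (z : ℂ_[p]) = toCp p z := (map_intCast (toCp p) z).symm
  rw [this, norm_toCp]
  exact PadicInt.norm_le_one _

theorem norm_natCast_le_one (z : ℕ) : ‖(z : ℂ_[p])‖ ≤ 1 := by
  exact_mod_cast norm_intCast_le_one (p := p) z

/-- The twisted sums at non-positive integers approach the Bernoulli values. Raising
`a'_c c = a + λ_a F` to the power `k + 1` shows that `(1 - ψ(c) c^{k+1})` times the leading term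
`-∑ ψ(a) a^{k+1} / ((k+1) F)` of the Bernoulli value is `∑ ψ(a) λ_a a^k` up to a multiple of `F`. -/
theorem exists_norm_sum_sub_bernoulliValue_le (p : ℕ) [Fact p.Prime] (k : ℕ) :
    ∃ C : ℝ, ∀ {M F : ℕ} (ψ : DirichletCharacter ℂ_[p] M) {c : ℤ}, 0 < F → M ∣ F →
      IsCoprime c (F : ℤ) → Odd c →
      ‖∑ a ∈ primeTo F, (twistCoeff F c a : ℂ_[p]) * (a : ℂ_[p]) ^ k * ψ (a : ZMod M) -
        (1 - ψ (c : ZMod M) * (c : ℂ_[p]) ^ (k + 1)) * bernoulliValue ψ k F‖ ≤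
        C * ‖(F : ℂ_[p])‖ := by
  let b (i : ℕ) : ℂ_[p] := algebraMap ℚ ℂ_[p] (bernoulli (i + 2) * (k + 1).choose (i + 2))
  let C1 : ℝ := ∑ i ∈ Finset.range k, ‖b i‖
  have hC1 : 0 ≤ C1 := Finset.sum_nonneg fun _ _ => norm_nonneg _
  refine ⟨‖(1 / (k + 1) : ℂ_[p])‖ + ‖(1 / 2 : ℂ_[p])‖ + ‖(1 / (k + 1) : ℂ_[p])‖ * C1, ?_⟩
  intro M F ψ c hF hMF hc hodd
  have hk : ((k : ℂ_[p]) + 1) ≠ 0 := by exact_mod_cast Nat.succ_ne_zero k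
  have hF' : (F : ℂ_[p]) ≠ 0 := Nat.cast_ne_zero.2 hF.ne'
  -- the higher terms of the Bernoulli polynomial
  let R (a : ℕ) : ℂ_[p] := ∑ i ∈ Finset.range k, b i * (a : ℂ_[p]) ^ (k - 1 - i) * (F : ℂ_[p]) ^ i
  have hR (a : ℕ) : ‖R a‖ ≤ C1 := by
    refine (norm_sum_le _ _).trans (Finset.sum_le_sum fun i _ => ?_)
    rw [norm_mul, norm_mul, norm_pow, norm_pow, mul_assoc]
    refine mul_le_of_le_one_right (norm_nonneg _) (mul_le_one₀ ?_ (by positivity) ?_)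
    · exact pow_le_one₀ (norm_nonneg _) (norm_natCast_le_one _)
    · exact pow_le_one₀ (norm_nonneg _) (norm_natCast_le_one _)
  -- integrality of the remainders of the two binomial expansions
  have hz (a : ℕ) : ∃ z : ℤ, ((c : ℂ_[p]) * aPrime F c a) ^ (k + 1) =
      (a : ℂ_[p]) ^ (k + 1) + (k + 1) * a ^ k * (lam F c a * F) + z * F ^ 2 := by
    obtain ⟨z, hz⟩ := Polynomial.powAddExpansion (a : ℤ) (lam F c a * F) (k + 1)
    refine ⟨z * lam F c a ^ 2, ?_⟩
    rw [lam_mul hF hc] at hz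
    rw [show (a : ℤ) + (aPrime F c a * c - a) = c * aPrime F c a by ring] at hz
    rw [← lam_mul hF hc] at hz
    have := congrArg (Int.cast : ℤ → ℂ_[p]) hz
    push_cast at this
    rw [this, Int.cast_mul, Int.cast_pow]
    ring
  have hw (a : ℕ) : ∃ w : ℤ, ((c : ℂ_[p]) * aPrime F c a) ^ k = (a : ℂ_[p]) ^ k + w * F := by
    have h1 : (F : ℤ) ∣ (c * aPrime F c a) ^ k - (a : ℤ) ^ k := by
      refine Dvd.dvd.trans ?_ (sub_dvd_pow_sub_pow _ _ k)
      rw [mul_comm c]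
      exact (aPrime_spec hF hc a).2.2
    obtain ⟨w, hw⟩ := h1
    refine ⟨w, ?_⟩
    have := congrArg (Int.cast : ℤ → ℂ_[p]) hw
    push_cast at this
    linear_combination this
  choose z hz using hz
  choose w hw using hw
  have hψ (x : ZMod F) (y : ZMod F) : ψ (ZMod.castHom hMF (ZMod M) (x * y)) =
      ψ (ZMod.castHom hMF (ZMod M) x) * ψ (ZMod.castHom hMF (ZMod M) y) := by
    rw [map_mul, map_mul]
  have key (j : ℕ) : ∑ a ∈ primeTo F, ((c : ℂ_[p]) * aPrime F c a) ^ j * ψ (a : ZMod M) =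
      ψ (c : ZMod M) * (c : ℂ_[p]) ^ j * ∑ a ∈ primeTo F, (a : ℂ_[p]) ^ j * ψ (a : ZMod M) := by
    have := sum_aPrime hF hc fun b x => ((c : ℂ_[p]) * b) ^ j * ψ (ZMod.castHom hMF (ZMod M) x)
    simp only [hψ, map_natCast, map_intCast] at this
    rw [this, Finset.mul_sum]
    exact Finset.sum_congr rfl fun a _ => by rw [mul_pow]; ring
  set E : ℂ_[p] := 1 - ψ (c : ZMod M) * (c : ℂ_[p]) ^ (k + 1) with hE
  have hEnorm : ‖E‖ ≤ 1 := by
    rw [hE, sub_eq_add_neg]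
    refine (IsUltrametricDist.norm_add_le_max _ _).trans (max_le norm_one.le ?_)
    rw [norm_neg, norm_mul, norm_pow]
    exact mul_le_one₀ (DirichletCharacter.norm_le_one _ _) (by positivity)
      (pow_le_one₀ (norm_nonneg _) (norm_intCast_le_one _))
  have hV : bernoulliValue ψ k F = ∑ a ∈ primeTo F, ψ (a : ZMod M) *
      (-(1 / (k + 1)) * ((a : ℂ_[p]) ^ (k + 1) / F) + 1 / 2 * (a : ℂ_[p]) ^ k -
        1 / (k + 1) * (F * R a)) := by
    rw [bernoulliValue, Finset.mul_sum]
    refine Finset.sum_congr rfl fun a _ => ?_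
    have h := bernoulli_eval_div (R := ℂ_[p]) k F hF.ne' a
    calc _ = ψ (a : ZMod M) * (-(1 / (k + 1)) * ((F : ℂ_[p]) ^ k *
          ((Polynomial.bernoulli (k + 1)).map (algebraMap ℚ ℂ_[p])).eval ((a : ℂ_[p]) / F))) := by
          ring
      _ = _ := by
          rw [h]
          simp only [R, b]
          field_simp
          ring
  have hsum1 : E * ∑ a ∈ primeTo F, (a : ℂ_[p]) ^ (k + 1) * ψ (a : ZMod M) =
      ∑ a ∈ primeTo F, -((k + 1) * a ^ k * (lam F c a * F) + z a * F ^ 2) * ψ (a : ZMod M) := by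
    rw [hE, sub_mul, one_mul, ← key, ← Finset.sum_sub_distrib]
    exact Finset.sum_congr rfl fun a _ => by rw [hz]; ring
  have hsum2 : E * ∑ a ∈ primeTo F, (a : ℂ_[p]) ^ k * ψ (a : ZMod M) =
      ∑ a ∈ primeTo F, ((1 - c) * (a : ℂ_[p]) ^ k - c * (w a * F)) * ψ (a : ZMod M) := by
    have h1 : ψ (c : ZMod M) * (c : ℂ_[p]) ^ (k + 1) *
        ∑ a ∈ primeTo F, (a : ℂ_[p]) ^ k * ψ (a : ZMod M) =
        c * ∑ a ∈ primeTo F, ((c : ℂ_[p]) * aPrime F c a) ^ k * ψ (a : ZMod M) := by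
      rw [key]; ring
    rw [hE, sub_mul, one_mul, h1, Finset.mul_sum, ← Finset.sum_sub_distrib]
    exact Finset.sum_congr rfl fun a _ => by rw [hw]; ring
  have htc (a : ℕ) : (twistCoeff F c a : ℂ_[p]) = lam F c a + (1 - c) / 2 := by
    have h2 : (1 - c) / 2 * 2 = 1 - c := by
      obtain ⟨j, rfl⟩ := hodd
      exact Int.ediv_mul_cancel ⟨-j, by ring⟩
    have h3 := congrArg (Int.cast : ℤ → ℂ_[p]) h2
    push_cast at h3
    rw [twistCoeff, Int.cast_add, ← h3]
    simp
  have hmain : ∑ a ∈ primeTo F, (twistCoeff F c a : ℂ_[p]) * (a : ℂ_[p]) ^ k * ψ (a : ZMod M) -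
      E * bernoulliValue ψ k F = F * ∑ a ∈ primeTo F, ψ (a : ZMod M) *
        (-(1 / (k + 1) * z a) + 1 / 2 * (c * w a) + 1 / (k + 1) * (E * R a)) := by
    have hV' : E * bernoulliValue ψ k F =
        -(1 / (k + 1)) / F * (E * ∑ a ∈ primeTo F, (a : ℂ_[p]) ^ (k + 1) * ψ (a : ZMod M)) +
        1 / 2 * (E * ∑ a ∈ primeTo F, (a : ℂ_[p]) ^ k * ψ (a : ZMod M)) -
        ∑ a ∈ primeTo F, ψ (a : ZMod M) * (1 / (k + 1) * (F * (E * R a))) := by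
      rw [hV]
      simp only [Finset.mul_sum]
      rw [← Finset.sum_add_distrib, ← Finset.sum_sub_distrib]
      exact Finset.sum_congr rfl fun a _ => by ring
    rw [hV', hsum1, hsum2]
    simp only [Finset.mul_sum]
    rw [← Finset.sum_add_distrib, ← Finset.sum_sub_distrib, ← Finset.sum_sub_distrib]
    refine Finset.sum_congr rfl fun a _ => ?_
    rw [htc]
    field_simp
    ring
  rw [hmain, norm_mul, mul_comm]
  refine mul_le_mul_of_nonneg_right ?_ (norm_nonneg _)
  refine IsUltrametricDist.norm_sum_le_of_forall_le_of_nonneg (by positivity) fun a _ => ?_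
  rw [norm_mul]
  refine (mul_le_of_le_one_left (norm_nonneg _) (DirichletCharacter.norm_le_one _ _)).trans ?_
  refine (norm_add_le _ _).trans (add_le_add ((norm_add_le _ _).trans (add_le_add ?_ ?_)) ?_)
  · rw [norm_neg, norm_mul]
    exact mul_le_of_le_one_right (norm_nonneg _) (norm_intCast_le_one _)
  · rw [norm_mul, norm_mul]
    exact mul_le_of_le_one_right (norm_nonneg _) (mul_le_one₀ (norm_intCast_le_one _)
      (norm_nonneg _) (norm_intCast_le_one _))
  · rw [norm_mul, norm_mul]
    refine mul_le_mul_of_nonneg_left ?_ (norm_nonneg _)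
    exact (mul_le_of_le_one_left (norm_nonneg _) hEnorm).trans (hR a)

end

/-! ### The twisted characters `χθ^{-m}` -/

theorem isCoprime_q {p : ℕ} {a : ℤ} (ha : IsCoprime a (p : ℤ)) : IsCoprime a (q p : ℕ) := by
  rw [Nat.cast_pow]
  exact ha.pow_right

section

variable {p : ℕ} [hp : Fact p.Prime]

theorem thetaChar_intCast {a : ℤ} (ha : IsCoprime a (p : ℤ)) :
    thetaChar p (a : ZMod (q p)) = toCp p (theta p (toUnit p a)) := by
  have h : (a : ZMod (q p)) = ((Units.map
      (PadicInt.toZModPow (p := p) (qExp p) : ℤ_[p] →* ZMod (q p)) (toUnit p a) :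
        (ZMod (q p))ˣ) : ZMod (q p)) := by
    rw [Units.coe_map, coe_toUnit ha]
    exact (map_intCast (PadicInt.toZModPow (p := p) (qExp p)) a).symm
  rw [h, thetaChar, MulChar.ofUnitHom_coe]
  rfl

theorem twistChar_intCast {N : ℕ} (χ : DirichletCharacter ℂ_[p] N) (m : ℕ) {a : ℤ}
    (haN : IsCoprime a (N : ℤ)) (ha : IsCoprime a (p : ℤ)) :
    twistChar χ m (a : ZMod _) =
      χ (a : ZMod N) * toCp p ((theta p (toUnit p a))⁻¹ : ℤ_[p]ˣ) ^ m := by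
  have haq := isCoprime_q ha
  have hl : IsCoprime a (N.lcm (q p) : ℕ) :=
    (haN.mul_right haq).of_isCoprime_of_dvd_right (by exact_mod_cast Nat.lcm_dvd_mul N (q p))
  have hu : IsUnit (a : ZMod (q p)) := (ZMod.coe_int_isUnit_iff_isCoprime a (q p)).2 haq.symm
  have hθ : ((thetaChar p)⁻¹ ^ m) (a : ZMod (q p)) =
      toCp p ((theta p (toUnit p a))⁻¹ : ℤ_[p]ˣ) ^ m := by
    have h1 : (thetaChar p)⁻¹ (a : ZMod (q p)) = toCp p ((theta p (toUnit p a))⁻¹ : ℤ_[p]ˣ) := by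
      rw [MulChar.inv_apply_eq_inv', thetaChar_intCast ha]
      refine inv_eq_of_mul_eq_one_right ?_
      rw [← map_mul, ← Units.val_mul, mul_inv_cancel, Units.val_one, map_one]
    rw [← h1]
    obtain ⟨u, hu⟩ := hu
    rw [← hu, MulChar.pow_apply_coe]
  rw [twistChar, DirichletCharacter.mul_def,
    DirichletCharacter.primitiveCharacter_apply_of_isCoprime _ hl, DirichletCharacter.mul,
    MulChar.mul_apply, DirichletCharacter.changeLevel_eq_cast_of_dvd' _ _ hl,
    DirichletCharacter.changeLevel_eq_cast_of_dvd' _ _ hl, hθ]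

theorem conductor_twistChar_dvd {N : ℕ} (χ : DirichletCharacter ℂ_[p] N) (m : ℕ) :
    (χ.mul ((thetaChar p)⁻¹ ^ m)).conductor ∣ N.lcm (q p) :=
  DirichletCharacter.conductor_dvd_level _

/-- The conductors of `χ` and of `χθ^{-m}` differ by a power of `p` only. -/
theorem dvd_conductor_twistChar {N : ℕ} [NeZero N] {χ : DirichletCharacter ℂ_[p] N}
    (hχ : χ.IsPrimitive) (m : ℕ) {l : ℕ} (hl : l.Prime) (hlp : l ≠ p) (hlN : l ∣ N) :
    l ∣ (χ.mul ((thetaChar p)⁻¹ ^ m)).conductor := by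
  have : NeZero (N.lcm (q p)) :=
    ⟨Nat.lcm_ne_zero (NeZero.ne N) (pow_ne_zero _ hp.out.ne_zero)⟩
  set θ' := (thetaChar p)⁻¹ ^ m with hθ'
  set A := DirichletCharacter.changeLevel (Nat.dvd_lcm_left N (q p)) χ with hA
  set B := DirichletCharacter.changeLevel (Nat.dvd_lcm_right N (q p)) θ' with hB
  have hAB : A = χ.mul θ' * B⁻¹ := by rw [DirichletCharacter.mul, ← hA, ← hB, mul_inv_cancel_right]
  have h1 := DirichletCharacter.conductor_mul_dvd_lcm_conductor (χ.mul θ') B⁻¹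
  rw [← hAB, hA, DirichletCharacter.conductor_changeLevel, hχ, DirichletCharacter.conductor_inv, hB,
    DirichletCharacter.conductor_changeLevel] at h1
  have h2 := (hlN.trans h1).trans (Nat.lcm_dvd_mul _ _)
  rcases hl.dvd_mul.1 h2 with h | h
  · exact h
  · have h3 := hl.dvd_of_dvd_pow (h.trans (DirichletCharacter.conductor_dvd_level _))
    exact absurd ((Nat.prime_dvd_prime_iff_eq hl hp.out).1 h3) hlp

theorem twistChar_eq_zero {N : ℕ} [NeZero N] {χ : DirichletCharacter ℂ_[p] N}
    (hχ : χ.IsPrimitive) (m : ℕ) {l : ℕ} (hl : l.Prime) (hlp : l ≠ p) (hlN : l ∣ N) :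
    twistChar χ m (l : ZMod _) = 0 := by
  refine MulChar.map_nonunit _ fun h => ?_
  rw [ZMod.isUnit_iff_coprime] at h
  exact hl.one_lt.ne'
    (Nat.eq_one_of_dvd_coprimes h dvd_rfl (dvd_conductor_twistChar hχ m hl hlp hlN))

/-! ### The `p`-adic limit of the twisted sums -/

/-- The sum `∑_a [λ_a(c) + (1 - c)/2] a⁻¹⟨a⟩^{1-s} χ(a)` over the integers `a` of `[1, F]` prime to
`F = lcm(f, q p^n)`. -/
noncomputable def levelSum (f : ℕ) (c : ℤ) {N : ℕ} (χ : DirichletCharacter ℂ_[p] N) (n : ℕ)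
    (s : ℤ_[p]) : ℂ_[p] :=
  ∑ a ∈ primeTo (f.lcm (level p n)),
    (twistCoeff (f.lcm (level p n)) c a : ℂ_[p]) * toCp p (weight p s a) * χ (a : ZMod N)

theorem approxSum_eq_levelSum (K : IntermediateField ℚ QBar) [IsAbelianField K] (c : ℤ) {N : ℕ}
    (χ : DirichletCharacter ℂ_[p] N) (s : ℤ_[p]) (n : ℕ) :
    approxSum K c χ s n = levelSum (conductor K) c χ n s := by
  rw [approxSum, levelSum, conductor_tower]

theorem norm_level (n : ℕ) : ‖(level p n : ℂ_[p])‖ = ‖((level p n : ℕ) : ℤ_[p])‖ := by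
  rw [← norm_toCp, map_natCast]

theorem norm_toCp_weight_sub_le {n : ℕ} {a b : ℤ} (s : ℤ_[p]) (ha : IsCoprime a (p : ℤ))
    (hb : IsCoprime b (p : ℤ)) (h : (level p n : ℤ) ∣ a - b) :
    ‖toCp p (weight p s a) - toCp p (weight p s b)‖ ≤ ‖(level p n : ℂ_[p])‖ := by
  rw [← map_sub, norm_toCp, norm_level, ← toZModPow_eq_iff]
  exact toZModPow_weight s ha hb h

section levelSum

variable {f N : ℕ}

/-- The sum at level `n` is the sum at level `n + 1` of the function that replaces `a` by its residue
modulo `lcm(f, qp^n)`; this changes each weight by a multiple of `qp^n`. -/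
theorem norm_levelSum_succ_sub_le (hf : 0 < f) (hN : N ∣ f) {c : ℤ} (hodd : Odd c)
    (hcp : IsCoprime c (p : ℤ)) (hcf : IsCoprime c (f : ℤ)) (χ : DirichletCharacter ℂ_[p] N)
    (n : ℕ) (s : ℤ_[p]) :
    ‖levelSum f c χ (n + 1) s - levelSum f c χ n s‖ ≤ ‖(level p n : ℂ_[p])‖ := by
  set F := f.lcm (level p n) with hF
  have hF0 : 0 < F := lcm_level_pos p hf n
  have : NeZero F := ⟨hF0.ne'⟩
  have hNF : N ∣ F := hN.trans (Nat.dvd_lcm_left _ _)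
  have hval (a : ℤ) : (F : ℤ) ∣ ((a : ZMod F).val : ℤ) - a := by
    rw [← ZMod.intCast_eq_intCast_iff_dvd_sub, Int.cast_natCast, ZMod.natCast_zmod_val]
  have hval' {a : ℤ} (ha : IsCoprime a (p : ℤ)) :
      IsCoprime ((a : ZMod F).val : ℤ) (p : ℤ) := by
    obtain ⟨k, hk⟩ := (Int.natCast_dvd_natCast.2 (dvd_lcm_level p f n)).trans (hval a)
    rw [show ((a : ZMod F).val : ℤ) = a + p * k by linarith]
    exact ha.add_mul_left_left k
  let h : ZMod F → ℂ_[p] := fun x =>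
    toCp p (weight p s (x.val : ℤ)) * χ (ZMod.castHom hNF (ZMod N) x)
  have key := sum_twistCoeff_level p hf hcf hcp hodd n h
  have hterm {a : ℕ} (ha : IsCoprime (a : ℤ) (p : ℤ)) :
      ‖toCp p (weight p s a) * χ (a : ZMod N) - h a‖ ≤ ‖(level p n : ℂ_[p])‖ := by
    have h1 : toCp p (weight p s a) * χ (a : ZMod N) - h a =
        (toCp p (weight p s a) - toCp p (weight p s ((((a : ℤ) : ZMod F)).val : ℤ))) *
          χ (a : ZMod N) := by
      simp only [h, map_natCast, Int.cast_natCast]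
      ring
    rw [h1, norm_mul]
    refine (mul_le_of_le_one_right (norm_nonneg _) (DirichletCharacter.norm_le_one _ _)).trans ?_
    refine norm_toCp_weight_sub_le s ha (hval' ha) ?_
    rw [dvd_sub_comm]
    exact (Int.natCast_dvd_natCast.2 (level_dvd_lcm p f n)).trans (hval a)
  have hdiff : levelSum f c χ (n + 1) s - levelSum f c χ n s =
      (∑ a ∈ primeTo (f.lcm (level p (n + 1))), (twistCoeff (f.lcm (level p (n + 1))) c a : ℂ_[p]) *
        (toCp p (weight p s a) * χ (a : ZMod N) - h a)) -
      ∑ a ∈ primeTo F, (twistCoeff F c a : ℂ_[p]) *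
        (toCp p (weight p s a) * χ (a : ZMod N) - h a) := by
    simp only [zsmul_eq_mul] at key
    simp only [mul_sub, Finset.sum_sub_distrib, levelSum, mul_assoc, ← hF] at key ⊢
    rw [key]
    ring
  have hsum (n' : ℕ) : ‖∑ a ∈ primeTo (f.lcm (level p n')),
      (twistCoeff (f.lcm (level p n')) c a : ℂ_[p]) *
        (toCp p (weight p s a) * χ (a : ZMod N) - h a)‖ ≤ ‖(level p n : ℂ_[p])‖ := by
    refine IsUltrametricDist.norm_sum_le_of_forall_le_of_nonneg (norm_nonneg _) fun a ha => ?_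
    rw [norm_mul]
    exact (mul_le_of_le_one_left (norm_nonneg _) (norm_intCast_le_one _)).trans
      (hterm (isCoprime_of_mem_primeTo_lcm ha))
  rw [hdiff, sub_eq_add_neg]
  refine (IsUltrametricDist.norm_add_le_max _ _).trans (max_le (hsum _) ?_)
  rw [norm_neg]
  exact hsum n

theorem norm_level_eq (n : ℕ) :
    ‖(level p n : ℂ_[p])‖ = ((p : ℝ)⁻¹) ^ qExp p * ((p : ℝ)⁻¹) ^ n := by
  rw [norm_level, Nat.cast_pow, PadicInt.norm_p_pow, zpow_neg, zpow_natCast, ← inv_pow, pow_add]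

theorem inv_prime_lt_one : (p : ℝ)⁻¹ < 1 := inv_lt_one_of_one_lt₀ (by exact_mod_cast hp.out.one_lt)

theorem tendsto_norm_level :
    Filter.Tendsto (fun n => ‖(level p n : ℂ_[p])‖) Filter.atTop (𝓝 0) := by
  simp only [norm_level_eq]
  rw [← mul_zero (((p : ℝ)⁻¹) ^ qExp p)]
  exact (tendsto_pow_atTop_nhds_zero_of_lt_one (by positivity) inv_prime_lt_one).const_mul _

theorem continuous_levelSum (f : ℕ) (c : ℤ) (χ : DirichletCharacter ℂ_[p] N) (n : ℕ) :
    Continuous (levelSum f c χ n) :=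
  continuous_finsetSum _ fun a _ =>
    (continuous_const.mul (continuous_toCp.comp (continuous_weight a))).mul continuous_const

/-- The twisted sums converge uniformly to a continuous function of `s ∈ ℤ_p`. -/
theorem exists_limit_levelSum (hf : 0 < f) (hN : N ∣ f) {c : ℤ} (hodd : Odd c)
    (hcp : IsCoprime c (p : ℤ)) (hcf : IsCoprime c (f : ℤ)) (χ : DirichletCharacter ℂ_[p] N) :
    ∃ G : ℤ_[p] → ℂ_[p], Continuous G ∧
      ∀ n s, ‖levelSum f c χ n s - G s‖ ≤ ‖(level p n : ℂ_[p])‖ := by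
  have hstep (s : ℤ_[p]) (n j : ℕ) :
      ‖levelSum f c χ (n + j) s - levelSum f c χ n s‖ ≤ ‖(level p n : ℂ_[p])‖ := by
    induction j with
    | zero => simp
    | succ j ih =>
      rw [← sub_add_sub_cancel _ (levelSum f c χ (n + j) s)]
      refine (IsUltrametricDist.norm_add_le_max _ _).trans (max_le ?_ ih)
      refine (norm_levelSum_succ_sub_le hf hN hodd hcp hcf χ (n + j) s).trans ?_
      rw [norm_level_eq, norm_level_eq]
      exact mul_le_mul_of_nonneg_left (pow_le_pow_of_le_one (by positivity) inv_prime_lt_one.le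
        (Nat.le_add_right n j)) (by positivity)
  have hcauchy (s : ℤ_[p]) : CauchySeq fun n => levelSum f c χ n s := by
    refine cauchySeq_of_le_geometric (p : ℝ)⁻¹ (((p : ℝ)⁻¹) ^ qExp p) inv_prime_lt_one fun n => ?_
    rw [dist_comm, dist_eq_norm, ← norm_level_eq]
    exact norm_levelSum_succ_sub_le hf hN hodd hcp hcf χ n s
  choose G hG using fun s => cauchySeq_tendsto_of_complete (hcauchy s)
  have hbound (n : ℕ) (s : ℤ_[p]) : ‖levelSum f c χ n s - G s‖ ≤ ‖(level p n : ℂ_[p])‖ := by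
    rw [norm_sub_rev]
    refine le_of_tendsto ((hG s).sub_const (levelSum f c χ n s)).norm ?_
    filter_upwards [Filter.eventually_ge_atTop n] with j hj
    obtain ⟨i, rfl⟩ := Nat.exists_eq_add_of_le hj
    exact hstep s n i
  refine ⟨G, ?_, hbound⟩
  have hunif : TendstoUniformly (fun n => levelSum f c χ n) G Filter.atTop := by
    rw [Metric.tendstoUniformly_iff]
    intro ε hε
    filter_upwards [(tendsto_norm_level (p := p)).eventually_lt_const hε] with n hn s
    rw [dist_comm, dist_eq_norm]
    exact (hbound n s).trans_lt hn
  exact hunif.continuous (Filter.Frequently.of_forall fun n => continuous_levelSum f c χ n)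

theorem tendsto_of_norm_sub_le {u : ℕ → ℂ_[p]} {x : ℂ_[p]}
    (h : ∀ n, ‖u n - x‖ ≤ ‖(level p n : ℂ_[p])‖) : Filter.Tendsto u Filter.atTop (𝓝 x) := by
  rw [tendsto_iff_norm_sub_tendsto_zero]
  exact squeeze_zero (fun _ => norm_nonneg _) h tendsto_norm_level

theorem primeFactors_lcm_level (hf : 0 < f) (n : ℕ) :
    (f.lcm (level p n)).primeFactors = insert p (f.primeFactors.erase p) := by
  ext l
  have h0 := (lcm_level_pos p hf n).ne'
  simp only [Nat.mem_primeFactors, Finset.mem_insert, Finset.mem_erase]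
  constructor
  · rintro ⟨hl, hd, -⟩
    by_cases h : l = p
    · exact Or.inl h
    · refine Or.inr ⟨h, hl, ?_, hf.ne'⟩
      rcases hl.dvd_mul.1 (hd.trans (Nat.lcm_dvd_mul _ _)) with h1 | h1
      · exact h1
      · exact absurd ((Nat.prime_dvd_prime_iff_eq hl hp.out).1 (hl.dvd_of_dvd_pow h1)) h
  · rintro (rfl | ⟨-, hl, hd, -⟩)
    · exact ⟨hp.out, dvd_lcm_level l f n, h0⟩
    · exact ⟨hl, hd.trans (Nat.dvd_lcm_left _ _), h0⟩

theorem one_lt_lcm_level (hf : 0 < f) (n : ℕ) : 1 < f.lcm (level p n) :=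
  hp.out.one_lt.trans_le (Nat.le_of_dvd (lcm_level_pos p hf n) (dvd_lcm_level p f n))

/-- The Euler factors that remain are those at `p` and at the primes dividing `f` but not `pN`: the
character `χθ^{-m}` vanishes at the other primes of `N`. -/
theorem map_bernoulliValue_level (ι : ℂ_[p] →+* ℂ) [NeZero N] (hf : 0 < f) (hN : N ∣ f)
    {χ : DirichletCharacter ℂ_[p] N} (hχ : χ.IsPrimitive) (m k n : ℕ) :
    ι (bernoulliValue (twistChar χ m) k (f.lcm (level p n))) =
      DirichletCharacter.LFunction ((twistChar χ m).ringHomComp ι) (-k) *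
        ((1 - ι (twistChar χ m p) * (p : ℂ) ^ k) *
          ∏ l ∈ f.primeFactors.filter (fun l => l ≠ p ∧ ¬ l ∣ N),
            (1 - ι (twistChar χ m l) * (l : ℂ) ^ k)) := by
  have : NeZero (f.lcm (level p n)) := ⟨(lcm_level_pos p hf n).ne'⟩
  have hM : (χ.mul ((thetaChar p)⁻¹ ^ m)).conductor ∣ f.lcm (level p n) :=
    (conductor_twistChar_dvd χ m).trans (Nat.lcm_dvd (hN.trans (Nat.dvd_lcm_left _ _))
      ((pow_dvd_pow p (Nat.le_add_right _ _)).trans (Nat.dvd_lcm_right _ _)))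
  rw [map_bernoulliValue, bernoulliValue_eq_LFunction_mul (one_lt_lcm_level hf n) hM,
    primeFactors_lcm_level hf, Finset.prod_insert (by simp)]
  simp only [MulChar.ringHomComp_apply]
  congr 2
  symm
  refine Finset.prod_subset (fun l hl => ?_) fun l hl hl' => ?_
  · obtain ⟨h1, h2, -⟩ := Finset.mem_filter.1 hl
    exact Finset.mem_erase.2 ⟨h2, h1⟩
  · obtain ⟨h1, h2⟩ := Finset.mem_erase.1 hl
    have h3 : l ∣ N := by
      by_contra h
      exact hl' (Finset.mem_filter.2 ⟨h2, h1, h⟩)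
    rw [twistChar_eq_zero hχ m (Nat.prime_of_mem_primeFactors h2) h1 h3, map_zero, zero_mul,
      sub_zero]

/-- The value does not depend on the level: its image in `ℂ` does not. -/
theorem bernoulliValue_level_eq (ι : ℂ_[p] →+* ℂ) [NeZero N] (hf : 0 < f) (hN : N ∣ f)
    {χ : DirichletCharacter ℂ_[p] N} (hχ : χ.IsPrimitive) (m k n : ℕ) :
    bernoulliValue (twistChar χ m) k (f.lcm (level p n)) =
      bernoulliValue (twistChar χ m) k (f.lcm (level p 0)) :=
  ι.injective (by rw [map_bernoulliValue_level ι hf hN hχ, map_bernoulliValue_level ι hf hN hχ])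

theorem twistFactor_one_sub {c : ℤ} (hcp : IsCoprime c (p : ℤ)) (hcN : IsCoprime c (N : ℤ))
    (χ : DirichletCharacter ℂ_[p] N) (m : ℕ) :
    twistFactor c χ (1 - (m : ℤ_[p])) = 1 - twistChar χ m c * (c : ℂ_[p]) ^ m := by
  rw [twistFactor, anglePow_one_sub hcp, twistChar_intCast χ _ hcN hcp, map_mul, map_pow, map_pow,
    map_intCast (toCp p)]
  ring

theorem mul_toCp_weight_one_sub {a : ℤ} (hap : IsCoprime a (p : ℤ)) (haN : IsCoprime a (N : ℤ))
    (χ : DirichletCharacter ℂ_[p] N) (k : ℕ) :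
    χ (a : ZMod N) * toCp p (weight p (1 - (k + 1 : ℕ)) a) =
      twistChar χ (k + 1) a * (a : ℂ_[p]) ^ k := by
  rw [weight_one_sub hap, twistChar_intCast χ _ haN hap, map_mul, map_pow, map_pow,
    map_intCast (toCp p)]
  ring

/-- Interpolation of the twisted sums at `s = 1 - m`, `m = k + 1`. -/
theorem tendsto_levelSum_one_sub (ι : ℂ_[p] →+* ℂ) [NeZero N] (hf : 0 < f) (hN : N ∣ f) {c : ℤ}
    (hodd : Odd c) (hcp : IsCoprime c (p : ℤ)) (hcf : IsCoprime c (f : ℤ)) {χ : DirichletCharacter ℂ_[p] N}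
    (hχ : χ.IsPrimitive) (k : ℕ) :
    Filter.Tendsto (fun n => levelSum f c χ n (1 - (k + 1 : ℕ))) Filter.atTop
      (𝓝 (twistFactor c χ (1 - (k + 1 : ℕ)) *
        bernoulliValue (twistChar χ (k + 1)) k (f.lcm (level p 0)))) := by
  have hcN : IsCoprime c (N : ℤ) := hcf.of_isCoprime_of_dvd_right (Int.natCast_dvd_natCast.2 hN)
  obtain ⟨C, hC⟩ := exists_norm_sum_sub_bernoulliValue_le p k
  rw [tendsto_iff_norm_sub_tendsto_zero]
  have hlim : Filter.Tendsto (fun n => |C| * ‖(level p n : ℂ_[p])‖) Filter.atTop (𝓝 0) := by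
    rw [← mul_zero |C|]
    exact tendsto_norm_level.const_mul _
  refine squeeze_zero (fun _ => norm_nonneg _) (fun n => ?_) hlim
  set F := f.lcm (level p n) with hF
  have hM : (χ.mul ((thetaChar p)⁻¹ ^ (k + 1))).conductor ∣ F :=
    (conductor_twistChar_dvd χ _).trans (Nat.lcm_dvd (hN.trans (Nat.dvd_lcm_left _ _))
      ((pow_dvd_pow p (Nat.le_add_right _ _)).trans (Nat.dvd_lcm_right _ _)))
  have h1 := hC (twistChar χ (k + 1)) (lcm_level_pos p hf n) hM (isCoprime_lcm_level p hcf hcp n)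
    hodd
  have h2 : levelSum f c χ n (1 - (k + 1 : ℕ)) = ∑ a ∈ primeTo F,
      (twistCoeff F c a : ℂ_[p]) * (a : ℂ_[p]) ^ k * twistChar χ (k + 1) a := by
    refine Finset.sum_congr rfl fun a ha => ?_
    have ha' := isCoprime_of_mem_primeTo ha
    have h3 := mul_toCp_weight_one_sub (isCoprime_of_mem_primeTo_lcm ha)
      (ha'.of_isCoprime_of_dvd_right (Int.natCast_dvd_natCast.2 (hN.trans (Nat.dvd_lcm_left _ _))))
      χ k
    simp only [Int.cast_natCast] at h3
    rw [mul_assoc, mul_comm (toCp p _), h3]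
    ring
  rw [h2, twistFactor_one_sub hcp hcN, ← bernoulliValue_level_eq ι hf hN hχ (k + 1) k n]
  refine h1.trans (mul_le_mul (le_abs_self C) ?_ (norm_nonneg _) (abs_nonneg _))
  obtain ⟨d, hd⟩ := level_dvd_lcm p f n
  rw [hd, Nat.cast_mul, norm_mul]
  exact mul_le_of_le_one_right (norm_nonneg _) (norm_natCast_le_one _)

end levelSum

end

/-! ### Existence and uniqueness of the `p`-adic `L`-function -/

section

variable {p : ℕ} [hp : Fact p.Prime]

theorem denseRange_one_sub_natCast : DenseRange fun k : ℕ => (1 - ((k + 1 : ℕ) : ℤ_[p])) := by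
  have h := (Homeomorph.neg ℤ_[p]).surjective.denseRange.comp PadicInt.denseRange_natCast
    (Homeomorph.neg ℤ_[p]).continuous
  convert! h using 2 with k
  simp

theorem one_sub_natCast_ne_one (k : ℕ) : (1 - ((k + 1 : ℕ) : ℤ_[p])) ≠ 1 := by
  rw [Ne, sub_eq_self]
  exact Nat.cast_ne_zero.2 (Nat.succ_ne_zero k)

/-- Functions continuous away from `s = 1` are determined by their values at the integers `1 - m`,
`m ≥ 1`. -/
theorem eqOn_of_eq_one_sub {S : Set ℤ_[p]} (hS : ∀ k : ℕ, (1 - ((k + 1 : ℕ) : ℤ_[p])) ∈ S)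
    {L L' : ℤ_[p] → ℂ_[p]} (hL : ContinuousOn L S) (hL' : ContinuousOn L' S)
    (h : ∀ k : ℕ, L (1 - (k + 1 : ℕ)) = L' (1 - (k + 1 : ℕ))) : Set.EqOn L L' S := by
  intro s hs
  set D := Set.range fun k : ℕ => (1 - ((k + 1 : ℕ) : ℤ_[p])) with hD
  have hDS : D ⊆ S := by rintro _ ⟨k, rfl⟩; exact hS k
  have : (𝓝[D] s).NeBot := mem_closure_iff_nhdsWithin_neBot.1 (denseRange_one_sub_natCast s)
  refine tendsto_nhds_unique ((hL s hs).mono hDS) (((hL' s hs).mono hDS).congr' ?_)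
  filter_upwards [self_mem_nhdsWithin] with x hx
  obtain ⟨k, rfl⟩ := hx
  exact (h k).symm

theorem continuous_twistFactor (c : ℤ) {N : ℕ} (χ : DirichletCharacter ℂ_[p] N) :
    Continuous (twistFactor c χ) :=
  continuous_const.sub (continuous_const.mul (continuous_toCp.comp
    ((continuous_anglePow _).comp (continuous_const.sub continuous_id))))

/-- Away from the possible pole some twist factor does not vanish. For `s ≠ 1` one may take `c ≡ 1`
modulo `Nq`: then `⟨c⟩ = c > 1` is not a root of unity. For `s = 1` any `c` with `χ(c) ≠ 1` will
do. -/
theorem exists_twistFactor_ne_zero {N : ℕ} [NeZero N] (χ : DirichletCharacter ℂ_[p] N) {s : ℤ_[p]}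
    (hs : χ ≠ 1 ∨ s ≠ 1) : ∃ c : ℤ, (Odd c ∧ IsCoprime c (p : ℤ) ∧ IsCoprime c (N : ℤ)) ∧
      twistFactor c χ s ≠ 0 := by
  by_cases h1 : s = 1
  · subst h1
    obtain ⟨u, hu⟩ := MulChar.ne_one_iff.1 (hs.resolve_right (by simp))
    obtain ⟨l, hl, hlp, hlu⟩ := Nat.forall_exists_prime_gt_and_eq_mod u.isUnit (2 + p + N)
    refine ⟨l, ⟨?_, ?_, ?_⟩, ?_⟩
    · exact_mod_cast hlp.odd_of_ne_two (by omega)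
    · rw [Nat.isCoprime_iff_coprime]
      exact (Nat.coprime_primes hlp hp.out).2 (by omega)
    · rw [Nat.isCoprime_iff_coprime]
      exact hlp.coprime_iff_not_dvd.2 (Nat.not_dvd_of_pos_of_lt (NeZero.pos N) (by omega))
    · rw [twistFactor, Int.cast_natCast, hlu, sub_self]
      have : anglePow p (toUnit p l) 0 = 1 := AddChar.map_zero_eq_one _
      rw [this, map_one, mul_one, sub_ne_zero]
      exact hu.symm
  · set c : ℕ := 1 + 2 * N * q p with hc
    have hcoe : (c : ℤ) = 1 + 2 * N * q p := by rw [hc]; push_cast; ring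
    have hcp : IsCoprime (c : ℤ) (p : ℤ) := by
      obtain ⟨d, hd⟩ : p ∣ q p := dvd_pow_self p (qExp_ne_zero p)
      refine ⟨1, -(2 * N * d), ?_⟩
      rw [hcoe, hd]
      push_cast
      ring
    refine ⟨c, ⟨⟨N * q p, by rw [hcoe]; ring⟩, hcp, ⟨1, -(2 * q p), by rw [hcoe]; ring⟩⟩, ?_⟩
    intro h0
    have hχ : χ (((c : ℕ) : ℤ) : ZMod N) = 1 := by
      have : ((c : ℕ) : ZMod N) = 1 := by rw [hc]; simp
      rw [Int.cast_natCast, this, map_one]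
    rw [twistFactor, hχ, one_mul, sub_eq_zero, eq_comm] at h0
    have h2 : anglePow p (toUnit p c) (1 - s) = 1 := by
      have hinj : Function.Injective (toCp p) :=
        (AddMonoidHomClass.isometry_of_norm (toCp p) norm_toCp).injective
      exact hinj (h0.trans (map_one _).symm)
    obtain ⟨v, hv⟩ := exists_pow_angle_eq_one (sub_ne_zero.2 (Ne.symm h1)) h2
    have hθ : theta p (toUnit p c) = 1 := by
      refine theta_eq_one ?_
      rw [coe_toUnit hcp, map_intCast, Int.cast_natCast, hc]
      push_cast
      have : ((p : ZMod (p ^ qExp p)) ^ qExp p) = 0 := by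
        exact_mod_cast CharP.cast_eq_zero (ZMod (p ^ qExp p)) (p ^ qExp p)
      rw [this, mul_zero, add_zero]
    rw [angle, hθ, inv_one, mul_one, coe_toUnit hcp, Int.cast_natCast] at hv
    have hv' : c ^ p ^ v = 1 := by exact_mod_cast hv
    have hq : 0 < q p := pow_pos hp.out.pos _
    have hNpos := NeZero.pos N
    have hlt : 1 < c := by
      have : 0 < 2 * N * q p := by positivity
      omega
    exact (Nat.one_lt_pow (pow_ne_zero v hp.out.ne_zero) hlt).ne' hv'

theorem eulerProduct_one_sub (K : IntermediateField ℚ QBar) {N : ℕ}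
    (χ : DirichletCharacter ℂ_[p] N) (k : ℕ) : eulerProduct K χ (1 - (k + 1 : ℕ)) =
      ∏ l ∈ (conductor K).primeFactors.filter (fun l => l ≠ p ∧ ¬ l ∣ N),
        (1 - twistChar χ (k + 1) l * (l : ℂ_[p]) ^ k) := by
  refine Finset.prod_congr rfl fun l hl => ?_
  obtain ⟨h1, h2, h3⟩ := Finset.mem_filter.1 hl
  have hl' := Nat.prime_of_mem_primeFactors h1
  have h4 := mul_toCp_weight_one_sub (p := p) (a := l)
    (Nat.isCoprime_iff_coprime.2 ((Nat.coprime_primes hl' hp.out).2 h2))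
    (Nat.isCoprime_iff_coprime.2 ((hl'.coprime_iff_not_dvd).2 h3)) χ k
  simp only [Int.cast_natCast] at h4
  rw [h4]

theorem continuous_eulerProduct (K : IntermediateField ℚ QBar) {N : ℕ}
    (χ : DirichletCharacter ℂ_[p] N) : Continuous (eulerProduct K χ) :=
  continuous_finsetProd _ fun l _ => continuous_const.sub (continuous_const.mul
    (continuous_toCp.comp (continuous_weight l)))

/-- The values of `L_p(s, χ)` at the integers `1 - m`, as Bernoulli values, determine a function
continuous on the domain of `L_p(s, χ)`: it is the quotient of the limit of the twisted sums by the
twist factor, for any twist whose factor does not vanish. -/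
theorem exists_continuousOn_interpolation (ι : ℂ_[p] →+* ℂ) {N : ℕ} [NeZero N]
    {χ : DirichletCharacter ℂ_[p] N} (hχ : χ.IsPrimitive) :
    ∃ L : ℤ_[p] → ℂ_[p], ContinuousOn L {s | χ ≠ 1 ∨ s ≠ 1} ∧ ∀ k : ℕ,
      L (1 - (k + 1 : ℕ)) = bernoulliValue (twistChar χ (k + 1)) k (N.lcm (level p 0)) := by
  classical
  let P (c : ℤ) : Prop := Odd c ∧ IsCoprime c (p : ℤ) ∧ IsCoprime c (N : ℤ)
  have hG (c : ℤ) : ∃ G : ℤ_[p] → ℂ_[p], P c → Continuous G ∧ ∀ k : ℕ,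
      G (1 - (k + 1 : ℕ)) = twistFactor c χ (1 - (k + 1 : ℕ)) *
        bernoulliValue (twistChar χ (k + 1)) k (N.lcm (level p 0)) := by
    by_cases hc : P c
    · obtain ⟨hodd, hcp, hcN⟩ := hc
      obtain ⟨G, hGc, hG⟩ := exists_limit_levelSum (NeZero.pos N) dvd_rfl hodd hcp hcN χ
      refine ⟨G, fun _ => ⟨hGc, fun k => ?_⟩⟩
      exact tendsto_nhds_unique (tendsto_of_norm_sub_le fun n => hG n _)
        (tendsto_levelSum_one_sub ι (NeZero.pos N) dvd_rfl hodd hcp hcN hχ k)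
    · exact ⟨0, fun h => absurd h hc⟩
  choose G hG using hG
  have hcross {c c' : ℤ} (hc : P c) (hc' : P c') (s : ℤ_[p]) :
      G c s * twistFactor c' χ s = G c' s * twistFactor c χ s := by
    refine congrFun (denseRange_one_sub_natCast.equalizer
      ((hG c hc).1.mul (continuous_twistFactor c' χ))
      ((hG c' hc').1.mul (continuous_twistFactor c χ)) (funext fun k => ?_)) s
    simp only [Function.comp_apply, Pi.mul_apply, (hG c hc).2, (hG c' hc').2]
    ring
  let L (s : ℤ_[p]) : ℂ_[p] :=
    if h : ∃ c, P c ∧ twistFactor c χ s ≠ 0 then G h.choose s / twistFactor h.choose χ s else 0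
  have hL {c : ℤ} (hc : P c) {s : ℤ_[p]} (hs : twistFactor c χ s ≠ 0) :
      L s = G c s / twistFactor c χ s := by
    have h : ∃ c, P c ∧ twistFactor c χ s ≠ 0 := ⟨c, hc, hs⟩
    simp only [L, dif_pos h]
    rw [div_eq_div_iff h.choose_spec.2 hs]
    exact hcross h.choose_spec.1 hc s
  refine ⟨L, fun s hs => ?_, fun k => ?_⟩
  · obtain ⟨c, hc, hs0⟩ := exists_twistFactor_ne_zero χ hs
    have hev : (fun t => G c t / twistFactor c χ t) =ᶠ[𝓝 s] L := by
      filter_upwards [(continuous_twistFactor c χ).continuousAt.eventually_ne hs0] with t ht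
      exact (hL hc ht).symm
    exact (((hG c hc).1.continuousAt.div (continuous_twistFactor c χ).continuousAt hs0).congr
      hev).continuousWithinAt
  · obtain ⟨c, hc, hs0⟩ := exists_twistFactor_ne_zero χ
      (Or.inr (one_sub_natCast_ne_one (p := p) k))
    rw [hL hc hs0, (hG c hc).2, mul_div_cancel_left₀ _ hs0]

/-- The interpolation property, read in `ℂ_p`: the complex `L`-values are the images of Bernoulli
values for the moduli `lcm(N, qp^n)`, whose primes outside `N` are at most `p`. -/
theorem isPadicLFunction_iff (ι : ℂ_[p] →+* ℂ) {N : ℕ} [NeZero N]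
    {χ : DirichletCharacter ℂ_[p] N} (hχ : χ.IsPrimitive) (L : ℤ_[p] → ℂ_[p]) :
    IsPadicLFunction ι χ L ↔ ContinuousOn L {s | χ ≠ 1 ∨ s ≠ 1} ∧ ∀ k : ℕ,
      L (1 - (k + 1 : ℕ)) = bernoulliValue (twistChar χ (k + 1)) k (N.lcm (level p 0)) := by
  have hval (k : ℕ) : ι (bernoulliValue (twistChar χ (k + 1)) k (N.lcm (level p 0))) =
      (1 - ι (twistChar χ (k + 1) p) * (p : ℂ) ^ (k + 1 - 1)) *
        DirichletCharacter.LFunction ((twistChar χ (k + 1)).ringHomComp ι) (1 - (k + 1 : ℕ)) := by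
    have hempty : N.primeFactors.filter (fun l => l ≠ p ∧ ¬ l ∣ N) = ∅ :=
      Finset.filter_eq_empty_iff.2 fun l hl h => h.2 (Nat.dvd_of_mem_primeFactors hl)
    rw [map_bernoulliValue_level ι (NeZero.pos N) dvd_rfl hχ, hempty, Finset.prod_empty, mul_one,
      mul_comm, Nat.add_sub_cancel, show (1 : ℂ) - (k + 1 : ℕ) = -k by push_cast; ring]
  refine ⟨fun h => ⟨h.continuousOn, fun k => ι.injective ?_⟩, fun h => ⟨h.1, fun m hm => ?_⟩⟩
  · rw [hval]
    exact h.interpolation (k + 1) (Nat.le_add_left 1 k)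
  · obtain ⟨k, rfl⟩ := Nat.exists_eq_add_of_le' hm
    rw [h.2, hval]

end

end StickelbergerMeasure

open StickelbergerMeasure in
theorem mainTheorem6 (p : ℕ) [Fact p.Prime] (ι : ℂ_[p] →+* ℂ)
    (K : IntermediateField ℚ QBar) [IsAbelianField K] [NumberField.IsTotallyReal K]
    (c : ℤ) (hc : Odd c) (hcp : IsCoprime c (p : ℤ)) (hcK : IsCoprime c (conductor K : ℤ)) :
    (∃ T : ∀ n : ℕ, MonoidAlgebra ℤ Gal(tower p K n/ℚ),
      (∀ n, MonoidAlgebra.mapRingHom _ (Int.castRingHom ℚ) (T n) =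
        twistedStickelberger (tower p K n) c) ∧
      (∀ n, T n = ∑ a ∈ primeTo (conductor (tower p K n)),
        MonoidAlgebra.single (artinSymbol (tower p K n) a)⁻¹
          (twistCoeff (conductor (tower p K n)) c a)) ∧
      (∀ n, normMap (tower_le p K n) (RingHom.id ℤ) (T (n + 1)) = T n) ∧
      ∀ s : ℤ_[p],
        (∀ n, normMap (tower_le p K n) (ZMod.castHom (level_dvd p n) (ZMod (level p n)))
          (mellinInt p K s (n + 1) (T (n + 1))) = mellinInt p K s n (T n)) ∧
        (∀ n, normMap le_sup_left (RingHom.id _) (mellinInt p K s n (T n)) =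
          ∑ a ∈ primeTo (conductor (tower p K n)),
            MonoidAlgebra.single (artinSymbol K a)
              (PadicInt.toZModPow (qExp p + n)
                ((twistCoeff (conductor (tower p K n)) c a : ℤ_[p]) * weight p s a)))) ∧
    ∀ (N : ℕ) [NeZero N] (χ : DirichletCharacter ℂ_[p] N), χ.IsPrimitive → IsCharacterOf p K χ →
      ∃ L : ℤ_[p] → ℂ_[p], IsPadicLFunction ι χ L ∧
        (∀ L', IsPadicLFunction ι χ L' → Set.EqOn L' L {s | χ ≠ 1 ∨ s ≠ 1}) ∧
        ∀ s : ℤ_[p], (χ ≠ 1 ∨ s ≠ 1) →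
          (∀ n, ‖approxSum K c χ s n - twistFactor c χ s * eulerProduct K χ s * L s‖ ≤
            ‖(level p n : ℂ_[p])‖) ∧
          Filter.Tendsto (approxSum K c χ s) Filter.atTop
            (𝓝 (twistFactor c χ s * eulerProduct K χ s * L s)) ∧
          ((∀ l : ℕ, l.Prime → l ∣ conductor K → l ≠ p → l ∣ N) → twistFactor c χ s ≠ 0 →
            Filter.Tendsto (fun n => (twistFactor c χ s)⁻¹ * approxSum K c χ s n) Filter.atTop
              (𝓝 (L s))) := by
  refine ⟨⟨fun n => integralStickelberger (tower p K n) c, fun n => ?_, fun n => rfl, fun n => ?_,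
    fun s => ⟨fun n => ?_, fun n => ?_⟩⟩, ?_⟩
  · refine mapRingHom_integralStickelberger _ hc ?_
    rw [conductor_tower]
    exact isCoprime_lcm_level p hcK hcp n
  · exact normMap_integralStickelberger p hc hcp hcK n
  · exact normMap_mellinInt_integralStickelberger p hc hcp hcK s n
  · exact normMap_le_sup_left_mellinInt p c s n
  intro N _ χ hχ hχK
  have hK0 := (conductor_spec K).1
  have hN := dvd_conductor_of_isCharacterOf hχ hχK
  have hS (k : ℕ) : (1 - ((k + 1 : ℕ) : ℤ_[p])) ∈ {s : ℤ_[p] | χ ≠ 1 ∨ s ≠ 1} :=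
    Or.inr (one_sub_natCast_ne_one k)
  obtain ⟨L, hLc, hLi⟩ := exists_continuousOn_interpolation ι hχ
  refine ⟨L, (isPadicLFunction_iff ι hχ L).2 ⟨hLc, hLi⟩, fun L' hL' => ?_, ?_⟩
  · obtain ⟨hLc', hLi'⟩ := (isPadicLFunction_iff ι hχ L').1 hL'
    exact eqOn_of_eq_one_sub hS hLc' hLc fun k => (hLi' k).trans (hLi k).symm
  obtain ⟨G, hGc, hG⟩ := exists_limit_levelSum hK0 hN hc hcp hcK χ
  -- the limit is computed at the integers `1 - m`, where both sides are Bernoulli values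
  have hGL : Set.EqOn G (fun s => twistFactor c χ s * eulerProduct K χ s * L s)
      {s | χ ≠ 1 ∨ s ≠ 1} := by
    refine eqOn_of_eq_one_sub hS hGc.continuousOn
      (((continuous_twistFactor c χ).mul (continuous_eulerProduct K χ)).continuousOn.mul hLc)
      fun k => ?_
    rw [tendsto_nhds_unique (tendsto_of_norm_sub_le fun n => hG n _)
      (tendsto_levelSum_one_sub ι hK0 hN hc hcp hcK hχ k), mul_assoc, hLi]
    congr 1
    apply ι.injective
    have hempty : N.primeFactors.filter (fun l => l ≠ p ∧ ¬ l ∣ N) = ∅ :=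
      Finset.filter_eq_empty_iff.2 fun l hl h => h.2 (Nat.dvd_of_mem_primeFactors hl)
    rw [map_mul, map_bernoulliValue_level ι hK0 hN hχ,
      map_bernoulliValue_level ι (NeZero.pos N) dvd_rfl hχ, hempty, Finset.prod_empty,
      eulerProduct_one_sub, map_prod]
    simp only [map_sub, map_one, map_mul, map_pow, map_natCast]
    ring
  intro s hs
  have hbound (n : ℕ) : ‖approxSum K c χ s n - twistFactor c χ s * eulerProduct K χ s * L s‖ ≤
      ‖(level p n : ℂ_[p])‖ := by
    have h := hG n s
    rwa [hGL hs, ← approxSum_eq_levelSum] at h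
  have hlim := tendsto_of_norm_sub_le hbound
  refine ⟨hbound, hlim, fun hl h0 => ?_⟩
  have hE : eulerProduct K χ s = 1 := by
    rw [eulerProduct, Finset.filter_eq_empty_iff.2, Finset.prod_empty]
    exact fun l hl' h => h.2 (hl l (Nat.prime_of_mem_primeFactors hl')
      (Nat.dvd_of_mem_primeFactors hl') h.1)
  have := hlim.const_mul (twistFactor c χ s)⁻¹
  rwa [hE, mul_one, inv_mul_cancel_left₀ h0] at this
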